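/- Let $r\ge 0$, let $\mathcal F\subset\Lambda_r=\mathbb C[t_1^{\pm1},\dots,t_r^{\pm1}]$ be a finite set, and let $V=V(\mathcal F)\subset(\mathbb C^*)^r$ be its zero set. **Notation.** For $f=\sum_{\lambda\in\mathcal L(f)}a_\lambda t^\lambda$ with $\mathcal L(f)\subset\mathbb Z^r$ finite and all $a_\lambda\ne 0$, let $\Pi_f$ be the set of partitions of $\mathcal L(f)$ all of whose blocks have at least two elements, and let $\Pi_{\mathcal F}=\prod_{f\in\mathcal F}\Pi_f$. For $\mathcal P\in\Pi_f$ let $\varepsilon(\mathcal P,f)\subset\mathbb Z^r$ be the subgroup generated by all $\lambda-\mu$ with $\lambda,\mu$ in a common block of $\mathcal P$. For $\pi=(\mathcal P_f)_{f\in\mathcal F}\in\Pi_{\mathcal F}$ let $\varepsilon(\pi,\mathcal F)=\sum_{f}\varepsilon(\mathcal P_f,f)$, and for $\mathcal U\subset\Pi_{\mathcal F}$ let $\varepsilon(\mathcal U,\mathcal F)=\sum_{\pi\in\mathcal U}\varepsilon(\pi,\mathcal F)$. For a subgroup $\varepsilon\subset\mathbb Z^r$ let $\overline\varepsilon=\{\lambda\in\mathbb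 Z^r: n\lambda\in\varepsilon\text{ for some integer }n\ge1\}$ be its saturation, let $V(\varepsilon)=\{x\in(\mathbb C^*)^r: x^\lambda=1\text{ for all }\lambda\in\varepsilon\}$, and let $D(\overline\varepsilon/\varepsilon)$ be the largest order of an element of the finite group $\overline\varepsilon/\varepsilon$. Put $D(\mathcal F)=\operatorname{lcm}\{D(\overline{\varepsilon(\mathcal U,\mathcal F)}/\varepsilon(\mathcal U,\mathcal F)):\mathcal U\subset\Pi_{\mathcal F}\}$. For $\mathcal P\in\Pi_f$ choose $\lambda_\nu\in\nu$ in each block $\nu\in\mathcal P$, and let $\mathcal V(\mathcal P,f)$ be the set of points $(x_\lambda)$ of $W(\mathcal P)^*=\prod_{\nu\in\mathcal P}(\mathbb C^*)^{\nu\setminus\{\lambda_\nu\}}$ with $\sum_{\lambda\in\nu\setminus\{\lambda_\nu\}}(-a_\lambda/a_{\lambda_\nu})x_\lambda=1$ for every $\nu\in\mathcal P$. Call such a point maximal if it is not of the form $(e_\lambda/e_{\lambda_\nu})$ for any $e\in(\mathbb C^*)^{\mathcal L(f)}$ satisfying $\sum_{\lambda\in\nu'}a_\lambda e_\lambda=0$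 for all blocks $\nu'$ of some proper refinement $\mathcal P'\in\Pi_f$ of $\mathcal P$. Let $S(\mathcal P,f)$ be the set of maximal points of $\mathcal V(\mathcal P,f)$ that have finite order in the group $W(\mathcal P)^*$. For $\pi\in\Pi_{\mathcal F}$ put $S(\pi,\mathcal F)=\prod_f S(\mathcal P_f,f)$, $M(\pi,\mathcal F)=\operatorname{lcm}\{\operatorname{ord}(x):x\in S(\pi,\mathcal F)\}$ and $M(\mathcal F)=\operatorname{lcm}\{M(\pi,\mathcal F):\pi\in\Pi_{\mathcal F}\}$. Let $\psi_{\mathcal P,f}:(\mathbb C^*)^r\to W(\mathcal P)^*$ be $x\mapsto(x^{\lambda-\lambda_\nu})$. Put $\delta_{\pi,\mathcal F}=1$ if there are points $\eta_f\in(\mathbb C^*)^r$ with $(\psi_{\mathcal P_f,f}(\eta_f))_f\in S(\pi,\mathcal F)$ and a character $\chi:\varepsilon(\pi,\mathcal F)\to\mathbb C^*$ with $\chi(\lambda)=\eta_f^\lambda$ for all $f\in\mathcal F$ and $\lambda\in\varepsilon(\mathcal P_f,f)$; put $\delta_{\pi,\mathcal F}=0$ otherwise. A *rational plane* is a set $\eta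 P$ with $P\subset(\mathbb C^*)^r$ a connected algebraic subgroup and $\eta\in(\mathbb C^*)^r$ of finite order. Let $p_V(n)$, $n\ge1$, be the number of $x\in V$ with $x^n=1$. A function $p$ on the positive integers is *polynomial periodic* if $p(n)=\sum_{i=0}^d a_i(n)n^i$ for all $n\geq 1$ with periodic functions $a_i$ (which are then unique); $\deg(p)$ is the largest $i$ with $a_i\not\equiv0$ (and $\deg(0)=0$), and $\operatorname{per}(p)$ is the least common multiple of the periods of the $a_i$. A maximum over the empty set is $0$, and a least common multiple over the empty set is $1$. **Theorem.** Every maximal rational plane contained in $V$ is a translate of $V(\overline{\varepsilon(\pi,\mathcal F)})$ for some $\pi\in\Pi_{\mathcal F}$. Moreover all the sets $S(\pi,\mathcal F)$ are finite, $p_V$ is polynomial periodic, $$\deg(p_V)=\max_{\pi\in\Pi_{\mathcal F}}\bigl(r-\operatorname{rank}\overline{\varepsilon(\pi,\mathcal F)}\bigr)\,\delta_{\pi,\mathcal F},$$ and $$\operatorname{per}(p_V)\ \big|\ M(\mathcal F)\,D(\mathcal F).$$ -/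

import Mathlib

noncomputable section

namespace TorsionCount

/-! ### The torus, Laurent polynomials and algebraic subsets -/

/-- The affine torus `(ℂ^*)^r`. -/
abbrev Torus (r : ℕ) : Type := Fin r → ℂˣ

/-- The exponent lattice `ℤ^r`. -/
abbrev Lattice (r : ℕ) : Type := Fin r → ℤ

/-- The ring `Λ_r = ℂ[t_1^{±1}, …, t_r^{±1}]` of Laurent polynomials, as the group ring of `ℤ^r`. -/
abbrev Laurent (r : ℕ) : Type := AddMonoidAlgebra ℂ (Lattice r)

variable {r : ℕ}

/-- The value `x^l = x_1^{l_1} ⋯ x_r^{l_r}` of the monomial `t^l` at `x`. -/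
def monomialAt (l : Lattice r) (x : Torus r) : ℂˣ := ∏ i, x i ^ l i

/-- The finite set `L(f)` of exponents that occur in `f` with nonzero coefficient. -/
def exponents (f : Laurent r) : Finset (Lattice r) := f.coeff.support

/-- The value of a Laurent polynomial at a point of the torus. -/
def evalAt (f : Laurent r) (x : Torus r) : ℂ :=
  ∑ l ∈ exponents f, f.coeff l * (monomialAt l x : ℂ)

/-- The zero set `V(G)` in the torus of a set of Laurent polynomials. -/
def zeroLocus (G : Set (Laurent r)) : Set (Torus r) := {x | ∀ f ∈ G, evalAt f x = 0}

/-- Algebraic (Zariski closed) subsets of the torus. -/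
def IsAlgebraic (Z : Set (Torus r)) : Prop := ∃ G : Set (Laurent r), Z = zeroLocus G

/-- An affine subtorus: a connected (in the Zariski topology) algebraic subgroup of the torus. -/
def IsAffineSubtorus (P : Subgroup (Torus r)) : Prop :=
  IsAlgebraic (P : Set (Torus r)) ∧
    ∀ A B : Set (Torus r), IsAlgebraic A → IsAlgebraic B →
      (P : Set (Torus r)) = A ∪ B → Disjoint A B → A = ∅ ∨ B = ∅

/-- The translate `η Z`. -/
def translate (η : Torus r) (Z : Set (Torus r)) : Set (Torus r) := (fun x => η * x) '' Z

/-- A rational plane: a translate of an affine subtorus by an element of finite order. -/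
def IsRationalPlane (Q : Set (Torus r)) : Prop :=
  ∃ (η : Torus r) (P : Subgroup (Torus r)),
    IsOfFinOrder η ∧ IsAffineSubtorus P ∧ Q = translate η (P : Set (Torus r))

/-- `Q` is a maximal element of the set of rational planes contained in `V`. -/
def IsMaximalRationalPlaneIn (V Q : Set (Torus r)) : Prop :=
  Maximal (fun Q' : Set (Torus r) => IsRationalPlane Q' ∧ Q' ⊆ V) Q

/-! ### Subgroups of the exponent lattice -/

/-- `V(ε)`: the common zeros of the binomials `t^l - 1`, for `l ∈ ε`. -/
def subgroupLocus (ε : AddSubgroup (Lattice r)) : Set (Torus r) :=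
  {x | ∀ l ∈ ε, monomialAt l x = 1}

/-- The saturation `{l ∈ ℤ^r : n l ∈ ε for some positive integer n}` of `ε`. -/
def saturation (ε : AddSubgroup (Lattice r)) : AddSubgroup (Lattice r) where
  carrier := {l | ∃ n : ℕ, 0 < n ∧ n • l ∈ ε}
  zero_mem' := ⟨1, Nat.one_pos, by simp [ε.zero_mem]⟩
  add_mem' := by
    rintro a b ⟨m, hm, ha⟩ ⟨n, hn, hb⟩
    refine ⟨m * n, Nat.mul_pos hm hn, ?_⟩
    rw [nsmul_add]
    refine ε.add_mem ?_ ?_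
    · rw [mul_comm, mul_nsmul']
      exact ε.nsmul_mem ha n
    · rw [mul_nsmul']
      exact ε.nsmul_mem hb m
  neg_mem' := by
    rintro a ⟨m, hm, ha⟩
    exact ⟨m, hm, by rw [smul_neg]; exact ε.neg_mem ha⟩

/-- The least common multiple of a set of natural numbers: the least positive common multiple
(which exists for finite sets of positive numbers). -/
def setLcm (s : Set ℕ) : ℕ := sInf {m | 0 < m ∧ ∀ k ∈ s, k ∣ m}

/-- The largest order of an element of the finite group `saturation ε / ε`. -/
def torsionExponent (ε : AddSubgroup (Lattice r)) : ℕ :=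
  sSup (Set.range fun g : saturation ε ⧸ ε.addSubgroupOf (saturation ε) => addOrderOf g)

/-! ### Partitions of the exponents of one Laurent polynomial -/

/-- `Π_f`: the partitions of `L(f)` all of whose blocks have at least two elements. -/
abbrev Partitions (f : Laurent r) : Type :=
  {P : Finpartition (exponents f) // ∀ ν ∈ P.parts, 2 ≤ ν.card}

/-- `ε(P, f)`: generated by the differences of exponents that lie in a common block of `P`. -/
def diffGroup {f : Laurent r} (P : Partitions f) : AddSubgroup (Lattice r) :=
  AddSubgroup.closure {d | ∃ ν ∈ P.1.parts, ∃ l ∈ ν, ∃ m ∈ ν, d = l - m}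

/-- The chosen element `λ_ν` of a nonempty finite set `ν` of exponents. -/
def base (ν : Finset (Lattice r)) : Lattice r :=
  open Classical in if h : ν.Nonempty then h.choose else 0

/-- The torus `W(P)^*`, the product over the blocks `ν` of `P` of `(ℂ^*)^{ν \ {λ_ν}}`. -/
abbrev ReducedTorus {f : Laurent r} (P : Partitions f) : Type :=
  (ν : {ν // ν ∈ P.1.parts}) → {l // l ∈ ν.1.erase (base ν.1)} → ℂˣ

/-- The monomial map `β_P : (ℂ^*)^{L(f)} → W(P)^*`, with coordinates `e_l / e_{λ_ν}`.
Here a point of `(ℂ^*)^{L(f)}` is given by a function on all of `ℤ^r`, of which only the values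
on `L(f)` matter. -/
def quotientMap {f : Laurent r} (P : Partitions f) (e : Lattice r → ℂˣ) : ReducedTorus P :=
  fun ν l => e l.1 / e (base ν.1)

/-- `T(P, f)`: the solutions of the homogeneous system `∑_{l ∈ ν} a_l e_l = 0`, `ν ∈ P`. -/
def homSolutions {f : Laurent r} (P : Partitions f) : Set (Lattice r → ℂˣ) :=
  {e | ∀ ν ∈ P.1.parts, ∑ l ∈ ν, f.coeff l * (e l : ℂ) = 0}

/-- `𝒱(P, f)`: the solutions in `W(P)^*` of the inhomogeneous system
`∑_{l ∈ ν \ {λ_ν}} (- a_l / a_{λ_ν}) x_l = 1`, `ν ∈ P`. -/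
def inhomSolutions {f : Laurent r} (P : Partitions f) : Set (ReducedTorus P) :=
  {x | ∀ ν, ∑ l, (-f.coeff l.1 / f.coeff (base ν.1)) * (x ν l : ℂ) = 1}

/-- The maximal solutions: those elements of `𝒱(P, f)` that do not come from a solution of the
larger system given by a proper refinement `P'` of `P`. -/
def maximalSolutions {f : Laurent r} (P : Partitions f) : Set (ReducedTorus P) :=
  {x | x ∈ inhomSolutions P ∧
    ∀ P' : Partitions f, P'.1 < P.1 → x ∉ quotientMap P '' homSolutions P'}

/-- `S(P, f)`: the maximal solutions of finite order. -/
def torsionSolutions {f : Laurent r} (P : Partitions f) : Set (ReducedTorus P) :=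
  {x | x ∈ maximalSolutions P ∧ IsOfFinOrder x}

/-- The monomial map `ψ_{P,f} : (ℂ^*)^r → W(P)^*`, with coordinates `x^{l - λ_ν}`. -/
def psi {f : Laurent r} (P : Partitions f) (x : Torus r) : ReducedTorus P :=
  fun ν l => monomialAt (l.1 - base ν.1) x

/-! ### Families of partitions for a finite set of Laurent polynomials -/

/-- `Π_F`: the product of the sets `Π_f`, for `f ∈ F`. -/
abbrev PartitionFamilies (F : Finset (Laurent r)) : Type := (f : {f // f ∈ F}) → Partitions f.1

variable {F : Finset (Laurent r)}

/-- `ε(π, F)`: the sum of the groups `ε(π_f, f)`. -/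
def famDiffGroup (π : PartitionFamilies F) : AddSubgroup (Lattice r) := ⨆ f, diffGroup (π f)

/-- `ε(U, F)`: the subgroup generated by the groups `ε(π, F)` with `π ∈ U`. -/
def unionDiffGroup (U : Set (PartitionFamilies F)) : AddSubgroup (Lattice r) :=
  ⨆ π ∈ U, famDiffGroup π

/-- `D(F)`: the least common multiple, over all subsets `U` of `Π_F`, of the largest order of an
element of `saturation ε(U, F) / ε(U, F)`. -/
def bigD (F : Finset (Laurent r)) : ℕ :=
  setLcm (Set.range fun U : Set (PartitionFamilies F) => torsionExponent (unionDiffGroup U))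

/-- `S(π, F)`: the product of the sets `S(π_f, f)`, inside the product of the tori `W(π_f)^*`. -/
def famTorsionSolutions (π : PartitionFamilies F) : Set ((f : {f // f ∈ F}) → ReducedTorus (π f)) :=
  {s | ∀ f, s f ∈ torsionSolutions (π f)}

/-- `M(π, F)`: the least common multiple of the orders of the elements of `S(π, F)`. -/
def famM (π : PartitionFamilies F) : ℕ := setLcm (orderOf '' famTorsionSolutions π)

/-- `M(F)`: the least common multiple of the numbers `M(π, F)`. -/
def bigM (F : Finset (Laurent r)) : ℕ := setLcm (Set.range fun π : PartitionFamilies F => famM π)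

/-- The characters of the subgroup `ε` of `ℤ^r`. -/
abbrev Characters (ε : AddSubgroup (Lattice r)) : Type := ε →+ Additive ℂˣ

theorem monomialAt_zero (x : Torus r) : monomialAt 0 x = 1 := by simp [monomialAt]

theorem monomialAt_add (l m : Lattice r) (x : Torus r) :
    monomialAt (l + m) x = monomialAt l x * monomialAt m x := by
  simp [monomialAt, zpow_add, Finset.prod_mul_distrib]

/-- The character `l ↦ x^l` of `ε` given by a point `x` of the torus. -/
def restrictPoint (ε : AddSubgroup (Lattice r)) (x : Torus r) : Characters ε where
  toFun l := Additive.ofMul (monomialAt l.1 x)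
  map_zero' := by simp [monomialAt_zero]
  map_add' l m := by simp [monomialAt_add]

/-- `γ^*`: dual to the inclusion of the product of the groups `ε(π_f, f)` into the product of
copies of `ℤ^r`. -/
def gammaDual (π : PartitionFamilies F) (η : {f // f ∈ F} → Torus r) :
    (f : {f // f ∈ F}) → Characters (diffGroup (π f)) :=
  fun f => restrictPoint (diffGroup (π f)) (η f)

/-- `ρ^*`: dual to the addition map from the product of the groups `ε(π_f, f)` to `ε(π, F)`; its
components are the restrictions of a character of `ε(π, F)`. -/
def rhoDual (π : PartitionFamilies F) (χ : Characters (famDiffGroup π)) :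
    (f : {f // f ∈ F}) → Characters (diffGroup (π f)) :=
  fun f => χ.comp (AddSubgroup.inclusion (le_iSup (fun g => diffGroup (π g)) f))

/-- The characters on the groups `ε(π_f, f)` that are given by points `η_f` of the torus lying
over the elements of `S(π, F)`. -/
def solutionCharacters (π : PartitionFamilies F) :
    Set ((f : {f // f ∈ F}) → Characters (diffGroup (π f))) :=
  gammaDual π '' {η | (fun f => psi (π f) (η f)) ∈ famTorsionSolutions π}

/-- `δ_{π,F}`: equal to `1` if some element of `S(π, F)` gives a family of characters in the image
of `ρ^*`, and to `0` otherwise. -/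
def delta (π : PartitionFamilies F) : ℕ :=
  open Classical in if (solutionCharacters π ∩ Set.range (rhoDual π)).Nonempty then 1 else 0

/-! ### Counting torsion points; polynomial periodic functions -/

/-- `p_V(n)`: the number of points `x` of `V` with `x^n = 1`. -/
def torsionCount (V : Set (Torus r)) (n : ℕ) : ℕ := Set.ncard {x | x ∈ V ∧ x ^ n = 1}

/-- `a` is a sequence `a_0, a_1, …` of periodic functions, finitely many of them nonzero, with
`p(n) = ∑ a_i(n) n^i` for every positive integer `n`. -/
def IsPeriodicCoeffs (p : ℕ → ℕ) (a : ℕ → ℕ → ℚ) : Prop :=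
  (∀ i, ∃ c, 0 < c ∧ Function.Periodic (a i) c) ∧
    ∃ d, (∀ i, d < i → a i = 0) ∧
      ∀ n, 0 < n → (p n : ℚ) = ∑ i ∈ Finset.range (d + 1), a i n * (n : ℚ) ^ i

/-- Polynomial periodic functions of a positive integer. -/
def IsPolynomialPeriodic (p : ℕ → ℕ) : Prop := ∃ a, IsPeriodicCoeffs p a

/-- The coefficient functions of a polynomial periodic function are unique. -/
theorem IsPeriodicCoeffs.unique {p : ℕ → ℕ} {a b : ℕ → ℕ → ℚ} (ha : IsPeriodicCoeffs p a)
    (hb : IsPeriodicCoeffs p b) : a = b := by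
  obtain ⟨hpa, d, hd, hda⟩ := ha
  obtain ⟨hpb, e, he, heb⟩ := hb
  choose ca hca0 hca using hpa
  choose cb hcb0 hcb using hpb
  set N := max d e with hN
  have key : ∀ (u : ℕ → ℕ → ℚ) (k : ℕ), k ≤ N → (∀ i, k < i → u i = 0) → ∀ n,
      ∑ i ∈ Finset.range (k + 1), u i n * (n : ℚ) ^ i
        = ∑ i ∈ Finset.range (N + 1), u i n * (n : ℚ) ^ i := by
    intro u k hk hu n
    refine Finset.sum_subset (fun i hi => ?_) (fun i _ hi => ?_)
    · simp only [Finset.mem_range] at hi ⊢; omega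
    · simp only [Finset.mem_range] at hi
      rw [hu i (by omega)]; simp
  set c := ∏ i ∈ Finset.range (N + 1), (ca i * cb i) with hc
  have hc0 : 0 < c := Finset.prod_pos fun i _ => Nat.mul_pos (hca0 i) (hcb0 i)
  funext i n
  by_cases hi : i ≤ N
  swap
  · rw [hd i (by omega), he i (by omega)]
  have hper : ∀ j ≤ N, ∀ m : ℕ, a j (n + m * c) = a j n ∧ b j (n + m * c) = b j n := by
    intro j hj m
    have hdvd : ca j * cb j ∣ c :=
      Finset.dvd_prod_of_mem (fun i => ca i * cb i) (Finset.mem_range.2 (by omega))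
    obtain ⟨q, hq⟩ := hdvd
    constructor
    · have h := (hca j).nat_mul (m * cb j * q) n
      rw [← h, hq]; congr 1; push_cast; ring
    · have h := (hcb j).nat_mul (m * ca j * q) n
      rw [← h, hq]; congr 1; push_cast; ring
  let g : Polynomial ℚ :=
    ∑ j ∈ Finset.range (N + 1), Polynomial.C (a j n - b j n) * Polynomial.X ^ j
  have hg : g = 0 := by
    refine Polynomial.eq_zero_of_infinite_isRoot g ?_
    refine Set.Infinite.mono (s := Set.range fun m : ℕ => ((n + (m + 1) * c : ℕ) : ℚ)) ?_ ?_
    · rintro _ ⟨m, rfl⟩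
      have hpos : 0 < n + (m + 1) * c := by positivity
      have h1 := (hda _ hpos).symm.trans (heb _ hpos)
      rw [key a d (le_max_left _ _) hd, key b e (le_max_right _ _) he] at h1
      simp only [Set.mem_ofPred_eq, Polynomial.IsRoot.def, g, Polynomial.eval_finsetSum,
        Polynomial.eval_mul, Polynomial.eval_C, Polynomial.eval_pow, Polynomial.eval_X, sub_mul,
        Finset.sum_sub_distrib]
      rw [sub_eq_zero]
      refine Eq.trans (Finset.sum_congr rfl fun j hj => ?_)
        (h1.trans (Finset.sum_congr rfl fun j hj => ?_))
      · rw [(hper j (by simpa [Nat.lt_succ_iff] using hj) (m + 1)).1]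
      · rw [(hper j (by simpa [Nat.lt_succ_iff] using hj) (m + 1)).2]
    · refine Set.infinite_range_of_injective fun m m' h => ?_
      have h' : n + (m + 1) * c = n + (m' + 1) * c := by exact_mod_cast h
      have := Nat.eq_of_mul_eq_mul_right hc0 (Nat.add_left_cancel h')
      omega
  have hcoeff : g.coeff i = a i n - b i n := by
    simp only [g, Polynomial.finsetSum_coeff, Polynomial.coeff_C_mul_X_pow]
    simp [hi]
  rw [hg, Polynomial.coeff_zero] at hcoeff
  linarith

/-- The coefficient functions `a_0, a_1, …` of a polynomial periodic function. -/
def periodicCoeffs (p : ℕ → ℕ) : ℕ → ℕ → ℚ :=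
  open Classical in if h : IsPolynomialPeriodic p then h.choose else 0

/-- The degree of a polynomial periodic function: the largest `d` such that `a_d` is not
identically zero; it is `0` for the zero function. -/
def ppDegree (p : ℕ → ℕ) : ℕ := sSup {d | periodicCoeffs p d ≠ 0}

/-- The least positive period of a periodic function. -/
def leastPeriod (a : ℕ → ℚ) : ℕ := sInf {c | 0 < c ∧ Function.Periodic a c}

/-- The period of a polynomial periodic function: the least common multiple of the periods of its
coefficient functions. -/
def ppPeriod (p : ℕ → ℕ) : ℕ := setLcm (Set.range fun i => leastPeriod (periodicCoeffs p i))

end TorsionCount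

end

noncomputable section

namespace TorsionCount

variable {r : ℕ}

/-! ### Linear relations between roots of unity -/

/-! A point `x` of `V` makes each sum of terms `a_l x^l` vanish. Splitting every such sum into
minimal vanishing subsums produces a family of partitions `π` for which `x` lies over a maximal
solution for each `f`; if `x` has finite order, so has that solution. Two points have the same image
under all the maps `psi (π f)` exactly when their monomials agree on `famDiffGroup π`. So the
torsion points of `V` are those of the sets `solutionFiber`, each of which is empty or a coset of
some V(ε).

There are finitely many such sets because a vanishing sum of roots of unity without vanishing proper
subsums, normalized to contain a root equal to 1, involves only roots of bounded order
(`exists_bound_nondegenerate`). The proof conjugates the relation by automorphisms fixing the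
coefficients and separates terms by Fourier inversion on p-th roots of unity.

In one coset of V(ε), the points with `x ^ n = 1` are the characters of ℤ^r that are trivial on nℤ^r
and prescribed on ε. Either there are none, or their number is the index of ε + nℤ^r, which is `n ^
(r - rank ε)` times the order of the n-torsion of the saturation modulo ε (`ncard_torsion_coset`).
Both the alternative and the last factor are periodic in n. A nonempty intersection of cosets is a
coset for the sum of the groups, so inclusion-exclusion gives polynomial periodicity and the bound
on the period. Each nonempty coset alone contributes at least `n ^ (r - rank ε)` points for suitable
n, so its growth cannot be cancelled; this fixes the degree.

The statement on rational planes is independent of the counting. On a coset of a group P, the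
monomials of f are grouped by their restrictions to P, and linear independence of characters makes
every group sum vanish. The coset then sits in a translate of V(ε), and connectedness replaces ε by
its saturation. -/

/-- The primitive `n`-th root of unity `exp (2πi / n)`. -/
def stdRoot (n : ℕ) : ℂ := Complex.exp (2 * Real.pi * Complex.I / n)

theorem stdRoot_isPrimitiveRoot {n : ℕ} (hn : n ≠ 0) : IsPrimitiveRoot (stdRoot n) n :=
  Complex.isPrimitiveRoot_exp n hn

theorem stdRoot_pow_div {n k : ℕ} (hn : n ≠ 0) (hk : k ∣ n) : stdRoot n ^ (n / k) = stdRoot k := by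
  obtain ⟨m, rfl⟩ := hk
  have hk : (k : ℂ) ≠ 0 := by
    rintro h; simp_all
  have hm : (m : ℂ) ≠ 0 := by
    rintro h; simp_all
  have hk' : 0 < k := Nat.pos_of_ne_zero fun h => hn (by simp [h])
  rw [Nat.mul_div_cancel_left _ hk', stdRoot, stdRoot, ← Complex.exp_nat_mul]
  congr 1
  push_cast
  field_simp

/-- The complex numbers of finite multiplicative order. -/
def torsionNumbers : Set ℂ := {z | ∃ n : ℕ, 0 < n ∧ z ^ n = 1}

/-- Every element of the field generated by all roots of unity is a rational polynomial in
`exp (2πi / N)` for some positive integer `N`. -/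
theorem exists_polynomial_stdRoot (z : ℂ) (hz : z ∈ IntermediateField.adjoin ℚ torsionNumbers) :
    ∃ N : ℕ, 0 < N ∧ ∃ g : Polynomial ℚ, z = Polynomial.aeval (stdRoot N) g := by
  have halg : ∀ x ∈ torsionNumbers, _root_.IsAlgebraic ℚ x := by
    rintro x ⟨n, hn, hx⟩
    refine IsIntegral.isAlgebraic ⟨Polynomial.X ^ n - 1, ?_, by simp [hx]⟩
    exact Polynomial.monic_X_pow_sub_C 1 hn.ne'
  rw [← IntermediateField.mem_toSubalgebra,
    IntermediateField.adjoin_toSubalgebra_of_isAlgebraic halg] at hz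
  have up : ∀ (N n : ℕ), n ≠ 0 → N ∣ n → ∀ g : Polynomial ℚ,
      ∃ g' : Polynomial ℚ, Polynomial.aeval (stdRoot N) g = Polynomial.aeval (stdRoot n) g' := by
    intro N n hn hNn g
    refine ⟨g.comp (Polynomial.X ^ (n / N)), ?_⟩
    rw [Polynomial.aeval_comp]
    simp [stdRoot_pow_div hn hNn]
  induction hz using Algebra.adjoin_induction with
  | mem x hx =>
    obtain ⟨n, hn, hx⟩ := hx
    have : NeZero n := ⟨hn.ne'⟩
    obtain ⟨i, -, rfl⟩ := (stdRoot_isPrimitiveRoot hn.ne').eq_pow_of_pow_eq_one hx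
    exact ⟨n, hn, Polynomial.X ^ i, by simp⟩
  | algebraMap q => exact ⟨1, one_pos, Polynomial.C q, by simp⟩
  | add x y _ _ hx hy =>
    obtain ⟨N, hN, g, rfl⟩ := hx
    obtain ⟨N', hN', g', rfl⟩ := hy
    have h0 : N * N' ≠ 0 := (Nat.mul_pos hN hN').ne'
    obtain ⟨k, hk⟩ := up N (N * N') h0 (Dvd.intro _ rfl) g
    obtain ⟨k', hk'⟩ := up N' (N * N') h0 (Dvd.intro_left _ rfl) g'
    exact ⟨N * N', Nat.mul_pos hN hN', k + k', by rw [hk, hk', map_add]⟩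
  | mul x y _ _ hx hy =>
    obtain ⟨N, hN, g, rfl⟩ := hx
    obtain ⟨N', hN', g', rfl⟩ := hy
    have h0 : N * N' ≠ 0 := (Nat.mul_pos hN hN').ne'
    obtain ⟨k, hk⟩ := up N (N * N') h0 (Dvd.intro _ rfl) g
    obtain ⟨k', hk'⟩ := up N' (N * N') h0 (Dvd.intro_left _ rfl) g'
    exact ⟨N * N', Nat.mul_pos hN hN', k * k', by rw [hk, hk', map_mul]⟩

/-- A relation between roots of unity with cyclotomic coefficients is preserved by the powers
that fix the coefficients. -/
theorem cyclotomic_relation_pow {ι : Type*} (s : Finset ι) (g : ι → Polynomial ℚ) {N n m : ℕ}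
    (hn : n ≠ 0) (hN : N ∣ n) (hcop : m.Coprime n) (hm : m ≡ 1 [MOD N]) (ζ : ι → ℂ)
    (hζ : ∀ i ∈ s, ζ i ^ n = 1)
    (h : ∑ i ∈ s, Polynomial.aeval (stdRoot N) (g i) * ζ i = 0) :
    ∑ i ∈ s, Polynomial.aeval (stdRoot N) (g i) * ζ i ^ m = 0 := by
  have : NeZero n := ⟨hn⟩
  have hprim := stdRoot_isPrimitiveRoot hn
  have hex : ∀ i : ι, ∃ k, i ∈ s → stdRoot n ^ k = ζ i := by
    intro i
    by_cases hi : i ∈ s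
    · obtain ⟨k, -, hk⟩ := hprim.eq_pow_of_pow_eq_one (hζ i hi)
      exact ⟨k, fun _ => hk⟩
    · exact ⟨0, fun h => absurd h hi⟩
  choose k hk using hex
  -- The relation as a rational polynomial evaluated at `stdRoot n`, using that `stdRoot N` is its
  -- power with exponent `n / N`. Vanishing at one primitive n-th root of unity, `G` vanishes at all
  -- of them, in particular at `stdRoot n ^ m`; and `m ≡ 1` modulo `N` leaves the coefficients
  -- unchanged.
  let G : Polynomial ℚ :=
    ∑ i ∈ s, (g i).comp (Polynomial.X ^ (n / N)) * Polynomial.X ^ k i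
  have hGx : ∀ x : ℂ, Polynomial.aeval x G
      = ∑ i ∈ s, Polynomial.aeval (x ^ (n / N)) (g i) * x ^ k i := by
    intro x
    simp [G, Polynomial.aeval_comp]
  have h0 : Polynomial.aeval (stdRoot n) G = 0 := by
    rw [hGx, stdRoot_pow_div hn hN, ← h]
    exact Finset.sum_congr rfl fun i hi => by rw [hk i hi]
  have hdvd : Polynomial.cyclotomic n ℚ ∣ G := by
    rw [Polynomial.cyclotomic_eq_minpoly_rat hprim (Nat.pos_of_ne_zero hn)]
    exact minpoly.dvd ℚ _ h0
  have hprim' := hprim.pow_of_coprime m hcop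
  have h1 : Polynomial.aeval (stdRoot n ^ m) G = 0 := by
    rw [Polynomial.cyclotomic_eq_minpoly_rat hprim' (Nat.pos_of_ne_zero hn)] at hdvd
    obtain ⟨q, hq⟩ := hdvd
    rw [hq, map_mul, minpoly.aeval, zero_mul]
  rw [hGx, ← pow_mul, mul_comm m, pow_mul, stdRoot_pow_div hn hN] at h1
  have hN0 : N ≠ 0 := fun h => hn (Nat.eq_zero_of_zero_dvd (h ▸ hN))
  have hNm : stdRoot N ^ m = stdRoot N := by
    have := (stdRoot_isPrimitiveRoot hN0).pow_eq_one
    conv_rhs => rw [← pow_one (stdRoot N)]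
    exact pow_eq_pow_of_modEq hm this
  rw [hNm] at h1
  rw [← h1]
  exact Finset.sum_congr rfl fun i hi => by rw [← hk i hi, ← pow_mul, ← pow_mul, mul_comm m]

/-- A relation between roots of unity with arbitrary complex coefficients is preserved by taking
powers with exponents congruent to `1` modulo an integer that only depends on the coefficients. -/
theorem exists_relation_pow {ι : Type*} (s : Finset ι) (a : ι → ℂ) :
    ∃ N : ℕ, 0 < N ∧ ∀ n m : ℕ, n ≠ 0 → N ∣ n → m.Coprime n → m ≡ 1 [MOD N] →
      ∀ ζ : ι → ℂ, (∀ i ∈ s, ζ i ^ n = 1) → ∑ i ∈ s, a i * ζ i = 0 →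
        ∑ i ∈ s, a i * ζ i ^ m = 0 := by
  classical
  let C := IntermediateField.adjoin ℚ torsionNumbers
  -- Coordinates along a basis of ℂ over the field `C` turn one relation into finitely many with
  -- coefficients in `C`. Only finitely many coordinates occur, so a single `N` makes them all
  -- polynomials in `stdRoot N`.
  let b := Module.Basis.ofVectorSpace C ℂ
  let B := s.biUnion fun i => (b.repr (a i)).support
  choose Nf hNf hg using fun z : C => exists_polynomial_stdRoot z.1 z.2
  let N := ∏ i ∈ s, ∏ j ∈ B, Nf (b.repr (a i) j)
  have hN : 0 < N := Finset.prod_pos fun i _ => Finset.prod_pos fun j _ => hNf _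
  have hdvd : ∀ i ∈ s, ∀ j ∈ B, Nf (b.repr (a i) j) ∣ N := fun i hi j hj =>
    (Finset.dvd_prod_of_mem (fun j => Nf (b.repr (a i) j)) hj).trans
      (Finset.dvd_prod_of_mem (fun i => ∏ j ∈ B, Nf (b.repr (a i) j)) hi)
  have hpoly : ∀ i j, ∃ g : Polynomial ℚ, i ∈ s → j ∈ B →
      ((b.repr (a i) j : C) : ℂ) = Polynomial.aeval (stdRoot N) g := by
    intro i j
    by_cases h : i ∈ s ∧ j ∈ B
    · have hd := hdvd i h.1 j h.2
      obtain ⟨g, hg⟩ := hg (b.repr (a i) j)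
      refine ⟨g.comp (Polynomial.X ^ (N / Nf (b.repr (a i) j))), fun _ _ => ?_⟩
      rw [Polynomial.aeval_comp, hg]
      simp [stdRoot_pow_div hN.ne' hd]
    · exact ⟨0, fun h1 h2 => absurd ⟨h1, h2⟩ h⟩
  choose g hg using hpoly
  have hmem : ∀ (ζ : ι → ℂ), (∀ i ∈ s, ζ i ∈ C) →
      (∑ i ∈ s, a i * ζ i = 0 ↔
        ∀ j ∈ B, ∑ i ∈ s, Polynomial.aeval (stdRoot N) (g i j) * ζ i = 0) := by
    intro ζ hζ
    have hsum : ∑ i ∈ s, a i * ζ i = ∑ j ∈ B,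
        (∑ i ∈ s, Polynomial.aeval (stdRoot N) (g i j) * ζ i) * b j := by
      simp_rw [Finset.sum_mul]
      rw [Finset.sum_comm]
      refine Finset.sum_congr rfl fun i hi => ?_
      have hsub : (b.repr (a i)).support ⊆ B :=
        Finset.subset_biUnion_of_mem (fun i => (b.repr (a i)).support) hi
      have hai : a i = ∑ j ∈ B, (b.repr (a i) j : ℂ) * b j := by
        conv_lhs => rw [← b.linearCombination_repr (a i)]
        rw [Finsupp.linearCombination_apply, Finsupp.sum_of_support_subset _ hsub _ (by simp)]
        rfl
      conv_lhs => rw [hai]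
      rw [Finset.sum_mul]
      exact Finset.sum_congr rfl fun j hj => by rw [hg i j hi hj]; ring
    constructor
    · intro h j hj
      rw [hsum] at h
      have hli := linearIndependent_iff'.1 b.linearIndependent B
        (fun j => ∑ i ∈ s.attach, b.repr (a i.1) j * ⟨ζ i.1, hζ i.1 i.2⟩) (by
          rw [← h]
          refine Finset.sum_congr rfl fun j hj => ?_
          rw [Algebra.smul_def]
          congr 1
          rw [map_sum, ← Finset.sum_attach s]
          refine Finset.sum_congr rfl fun i _ => ?_
          rw [map_mul, ← hg i.1 j i.2 hj]
          rfl) j hj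
      have := congrArg (algebraMap C ℂ) hli
      rw [map_sum, map_zero] at this
      rw [← this, ← Finset.sum_attach s]
      refine Finset.sum_congr rfl fun i _ => ?_
      rw [map_mul, ← hg i.1 j i.2 hj]
      rfl
    · intro h
      rw [hsum]
      exact Finset.sum_eq_zero fun j hj => by rw [h j hj, zero_mul]
  refine ⟨N, hN, fun n m hn hNn hcop hm ζ hζ h => ?_⟩
  have hC : ∀ i ∈ s, ζ i ∈ C := fun i hi =>
    IntermediateField.subset_adjoin _ _ ⟨n, Nat.pos_of_ne_zero hn, hζ i hi⟩
  refine (hmem _ fun i hi => pow_mem (hC i hi) m).2 fun j hj => ?_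
  exact cyclotomic_relation_pow s _ hn hNn hcop hm ζ hζ ((hmem ζ hC).1 h j hj)

theorem sum_pow_root_of_unity {p : ℕ} {w : ℂ} (hw : w ^ p = 1) :
    ∑ j ∈ Finset.range p, w ^ j = if w = 1 then (p : ℂ) else 0 := by
  split_ifs with h
  · simp [h]
  · have := geom_sum_eq h p
    rw [this, hw]; simp

/-- The nondegenerate solutions in roots of unity of a homogeneous linear equation, normalized by
setting one coordinate equal to `1`, have bounded order. -/
theorem exists_bound_nondegenerate {ι : Type*} (s : Finset ι) (a : ι → ℂ) :
    ∃ B : ℕ, 0 < B ∧ ∀ ζ : ι → ℂ, (∀ i ∈ s, ζ i ∈ torsionNumbers) → (∃ i ∈ s, ζ i = 1) →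
      ∑ i ∈ s, a i * ζ i = 0 →
      (∀ t ⊆ s, t.Nonempty → ∑ i ∈ t, a i * ζ i = 0 → t = s) → ∀ i ∈ s, ζ i ^ B = 1 := by
  classical
  obtain ⟨N, hN, hpow⟩ := exists_relation_pow s a
  -- For `q` a multiple of this bound, the factor `N` gives `1 + j * q ≡ 1` modulo `N`, and the
  -- factorial makes every prime not dividing `q` larger than `s.card`.
  refine ⟨N * s.card.factorial, Nat.mul_pos hN (Nat.factorial_pos _), ?_⟩
  set B := N * s.card.factorial with hB
  have hB0 : 0 < B := Nat.mul_pos hN (Nat.factorial_pos _)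
  intro ζ htor ⟨i₀, hi₀, hone⟩ hsum hmin
  have hex : ∃ n, 0 < n ∧ B ∣ n ∧ ∀ i ∈ s, ζ i ^ n = 1 := by
    choose! k hk0 hk using htor
    refine ⟨B * ∏ i ∈ s, k i, Nat.mul_pos hB0 (Finset.prod_pos fun i hi => hk0 i hi),
      Dvd.intro _ rfl, fun i hi => ?_⟩
    obtain ⟨q, hq⟩ := Finset.dvd_prod_of_mem k hi
    rw [hq, mul_left_comm, pow_mul, hk i hi, one_pow]
  obtain ⟨hn0, hBn, hζn⟩ := Nat.find_spec hex
  have hnmin : ∀ m, 0 < m → B ∣ m → (∀ i ∈ s, ζ i ^ m = 1) → Nat.find hex ≤ m :=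
    fun m h1 h2 h3 => Nat.find_min' hex ⟨h1, h2, h3⟩
  set n := Nat.find hex
  by_cases hnB : n = B
  · rwa [hnB] at hζn
  exfalso
  obtain ⟨c, hc⟩ := hBn
  have hc1 : c ≠ 1 := fun h => hnB (by rw [hc, h, mul_one])
  -- With `n` the least multiple of `B` that kills all the roots, `q = n / p` is a smaller multiple
  -- of `B`. The contradiction will be that `q` kills them as well.
  obtain ⟨p, hp, q', hq'⟩ := Nat.exists_prime_and_dvd hc1
  set q := B * q' with hq
  have hnq : n = q * p := by rw [hc, hq', hq]; ring
  have hq0 : 0 < q := Nat.pos_of_ne_zero fun h => hn0.ne' (by rw [hnq, h, zero_mul])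
  have hω : ∀ i ∈ s, (ζ i ^ q) ^ p = 1 := fun i hi => by rw [← pow_mul, ← hnq, hζn i hi]
  -- The exponent `1 + j * q` is always prime to `q`, so it is prime to `n = q * p` unless `p`
  -- divides it.
  have hF : ∀ j, ¬ p ∣ 1 + j * q → ∑ i ∈ s, a i * ζ i * (ζ i ^ q) ^ j = 0 := by
    intro j hj
    have hcop : (1 + j * q).Coprime n := by
      rw [hnq]
      refine Nat.Coprime.mul_right ?_ ?_
      · simp
      · exact ((Nat.Prime.coprime_iff_not_dvd hp).2 hj).symm
    have hmod : 1 + j * q ≡ 1 [MOD N] := by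
      have : N ∣ j * q := by
        rw [hq, hB]; exact Dvd.intro (j * (s.card.factorial * q')) (by ring)
      simpa using (Nat.ModEq.refl 1).add ((Nat.modEq_zero_iff_dvd).2 this)
    have hNn : N ∣ n := by rw [hc, hB, mul_assoc]; exact Dvd.intro _ rfl
    have := hpow n _ hn0.ne' hNn hcop hmod ζ hζn hsum
    rw [← this]
    refine Finset.sum_congr rfl fun i _ => ?_
    rw [pow_add, pow_one, mul_comm j q, pow_mul (ζ i) q j, mul_assoc]
  -- Fourier inversion over the p-th roots of unity isolates the terms with `ζ i ^ q = w`.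
  have hA : ∀ w : ℂ, w ^ p = 1 →
      ∑ j ∈ Finset.range p, (∑ i ∈ s, a i * ζ i * (ζ i ^ q) ^ j) * (w⁻¹) ^ j
        = p * ∑ i ∈ s with ζ i ^ q = w, a i * ζ i := by
    intro w hw
    have hw0 : w ≠ 0 := fun h => by rw [h, zero_pow hp.ne_zero] at hw; exact zero_ne_one hw
    simp_rw [Finset.sum_mul]
    rw [Finset.sum_comm, Finset.sum_filter, Finset.mul_sum]
    refine Finset.sum_congr rfl fun i hi => ?_
    have h1 : (ζ i ^ q * w⁻¹) ^ p = 1 := by rw [mul_pow, hω i hi, inv_pow, hw]; simp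
    have h2 := sum_pow_root_of_unity h1
    simp_rw [mul_assoc, ← mul_pow]
    rw [← Finset.mul_sum, ← Finset.mul_sum, h2]
    simp only [mul_inv_eq_one₀ hw0]
    split_ifs <;> ring
  have hall : ∀ j ∈ Finset.range p, ∑ i ∈ s, a i * ζ i * (ζ i ^ q) ^ j = 0 := by
    by_cases hpq : p ∣ q
    · intro j _
      refine hF j fun h => hp.one_lt.ne' ?_
      exact Nat.dvd_one.1 ((Nat.dvd_add_left (hpq.mul_left j)).1 h)
    · have hcard : s.card < p := by
        by_contra! hle
        refine hpq ?_
        have := Nat.dvd_factorial hp.pos hle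
        rw [hq, hB]
        exact (this.mul_left N).mul_right q'
      obtain ⟨w, hw, hwn⟩ : ∃ w ∈ Polynomial.nthRootsFinset p (1 : ℂ),
          w ∉ s.image fun i => ζ i ^ q := by
        refine Finset.exists_mem_notMem_of_card_lt_card ?_
        rw [(stdRoot_isPrimitiveRoot hp.ne_zero).card_nthRootsFinset]
        exact Finset.card_image_le.trans_lt hcard
      have hwp : w ^ p = 1 := (Polynomial.mem_nthRootsFinset hp.pos _).1 hw
      have hw0 : w ≠ 0 := fun h => by rw [h, zero_pow hp.ne_zero] at hwp; exact zero_ne_one hwp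
      have hempty : (s.filter fun i => ζ i ^ q = w) = ∅ := by
        rw [Finset.filter_eq_empty_iff]
        exact fun i hi h => hwn (Finset.mem_image.2 ⟨i, hi, h⟩)
      have h0 := hA w hwp
      rw [hempty, Finset.sum_empty, mul_zero] at h0
      intro j hj
      by_cases hjp : p ∣ 1 + j * q
      · rw [Finset.sum_eq_single_of_mem j hj] at h0
        · exact (mul_eq_zero.1 h0).resolve_right (pow_ne_zero _ (inv_ne_zero hw0))
        · intro j' hj' hne
          rw [hF j' fun hj'p => hne ?_, zero_mul]
          have h1 : 1 + j' * q ≡ 1 + j * q [MOD p] :=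
            ((Nat.modEq_zero_iff_dvd).2 hj'p).trans ((Nat.modEq_zero_iff_dvd).2 hjp).symm
          have h2 : j' * q ≡ j * q [MOD p] := Nat.ModEq.add_left_cancel' 1 h1
          have h3 : j' ≡ j [MOD p] :=
            Nat.ModEq.cancel_right_of_coprime ((Nat.Prime.coprime_iff_not_dvd hp).2 hpq) h2
          exact Nat.ModEq.eq_of_lt_of_lt h3 (Finset.mem_range.1 hj') (Finset.mem_range.1 hj)
      · exact hF j hjp
  have h1 := hA 1 (one_pow p)
  rw [Finset.sum_eq_zero fun j hj => by rw [hall j hj, zero_mul]] at h1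
  have h2 : ∑ i ∈ s with ζ i ^ q = 1, a i * ζ i = 0 :=
    (mul_eq_zero.1 h1.symm).resolve_left (Nat.cast_ne_zero.2 hp.ne_zero)
  -- The subsum is nonempty because it contains the normalized term `i₀`, so nondegeneracy makes it
  -- the whole sum.
  have h3 := hmin _ (Finset.filter_subset _ _) ⟨i₀, by simp [hi₀, hone]⟩ h2
  rw [Finset.filter_eq_self] at h3
  have h4 := hnmin q hq0 (Dvd.intro _ rfl) h3
  rw [hnq] at h4
  have := hp.two_le
  nlinarith

/-! ### Characters of the exponent lattice -/

theorem monomialAt_single (i : Fin r) (x : Torus r) : monomialAt (Pi.single i 1) x = x i := by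
  rw [monomialAt, Finset.prod_eq_single i]
  · simp
  · intro j _ hj; simp [hj]
  · simp

theorem monomialAt_neg (l : Lattice r) (x : Torus r) :
    monomialAt (-l) x = (monomialAt l x)⁻¹ := by
  simp [monomialAt]

theorem monomialAt_sub (l m : Lattice r) (x : Torus r) :
    monomialAt (l - m) x = monomialAt l x / monomialAt m x := by
  rw [sub_eq_add_neg, monomialAt_add, monomialAt_neg, div_eq_mul_inv]

theorem monomialAt_nsmul (n : ℕ) (l : Lattice r) (x : Torus r) :
    monomialAt (n • l) x = monomialAt l x ^ n := by
  simp [monomialAt, Finset.prod_pow, mul_comm (n : ℤ), zpow_mul]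

theorem monomialAt_mul (l : Lattice r) (x y : Torus r) :
    monomialAt l (x * y) = monomialAt l x * monomialAt l y := by
  simp [monomialAt, mul_zpow, Finset.prod_mul_distrib]

theorem monomialAt_one (l : Lattice r) : monomialAt l (1 : Torus r) = 1 := by simp [monomialAt]

theorem monomialAt_inv (l : Lattice r) (x : Torus r) :
    monomialAt l x⁻¹ = (monomialAt l x)⁻¹ := by
  simp [monomialAt]

theorem monomialAt_div (l : Lattice r) (x y : Torus r) :
    monomialAt l (x / y) = monomialAt l x / monomialAt l y := by
  rw [div_eq_mul_inv, monomialAt_mul, monomialAt_inv, div_eq_mul_inv]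

theorem monomialAt_pow (l : Lattice r) (x : Torus r) (n : ℕ) :
    monomialAt l (x ^ n) = monomialAt l x ^ n := by
  induction n with
  | zero => simp [monomialAt_one]
  | succ n ih => rw [pow_succ, monomialAt_mul, ih, pow_succ]

/-- Points of the torus are the characters of the exponent lattice. -/
def torusEquivCharacters : Torus r ≃ (Lattice r →+ Additive ℂˣ) where
  toFun x :=
    { toFun := fun l => Additive.ofMul (monomialAt l x)
      map_zero' := by simp [monomialAt_zero]
      map_add' := fun l m => by simp [monomialAt_add] }
  invFun φ := fun i => (φ (Pi.single i 1)).toMul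
  left_inv x := by
    funext i
    simp [monomialAt_single]
  right_inv φ := by
    refine AddMonoidHom.ext fun l => ?_
    change Additive.ofMul (monomialAt l _) = φ l
    conv_rhs => rw [← Finset.univ_sum_single l, map_sum]
    rw [monomialAt, ofMul_prod]
    refine Finset.sum_congr rfl fun i _ => ?_
    have : (Pi.single i (l i) : Lattice r) = l i • Pi.single i 1 := by
      rw [← Pi.single_smul]; simp
    rw [this, map_zsmul]
    rfl

theorem torusEquivCharacters_apply (x : Torus r) (l : Lattice r) :
    torusEquivCharacters x l = Additive.ofMul (monomialAt l x) := rfl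

theorem pow_eq_one_iff_monomialAt (x : Torus r) (n : ℕ) :
    x ^ n = 1 ↔ ∀ l : Lattice r, monomialAt (n • l) x = 1 := by
  constructor
  · intro h l
    rw [monomialAt_nsmul, ← monomialAt_pow, h, monomialAt_one]
  · intro h
    funext i
    have := h (Pi.single i 1)
    rw [monomialAt_nsmul, monomialAt_single] at this
    simpa using this

/-- The group ℂˣ is divisible since ℂ is algebraically closed, hence injective over ℤ. This is what
allows characters of subgroups of the lattice to be extended. -/
theorem baer_units : Module.Baer ℤ (Additive ℂˣ) := by
  have hnat : ∀ {n : ℕ} (a : Additive ℂˣ), n ≠ 0 → ∃ b : Additive ℂˣ, n • b = a := by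
    intro n a hn
    obtain ⟨z, hz⟩ := IsAlgClosed.exists_pow_nat_eq ((a.toMul : ℂˣ) : ℂ) (Nat.pos_of_ne_zero hn)
    have hz0 : z ≠ 0 := fun h => by
      rw [h, zero_pow hn] at hz
      exact a.toMul.ne_zero hz.symm
    refine ⟨Additive.ofMul (Units.mk0 z hz0), ?_⟩
    apply Additive.toMul.injective
    ext
    simpa using hz
  have hint : ∀ (n : ℤ) (a : Additive ℂˣ), n ≠ 0 → ∃ b : Additive ℂˣ, n • b = a := by
    intro n a hn
    obtain ⟨b, hb⟩ := hnat a (Int.natAbs_ne_zero.2 hn)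
    rcases Int.natAbs_eq n with h | h
    · exact ⟨b, by rw [h, natCast_zsmul, hb]⟩
    · exact ⟨-b, by rw [h, neg_smul_neg, natCast_zsmul, hb]⟩
  classical
  let _ : DivisibleBy (Additive ℂˣ) ℤ :=
    { div := fun a n => if h : n ≠ 0 then (hint n a h).choose else 0
      div_zero := fun a => by simp
      div_cancel := fun {n} a hn => by
        rw [dif_pos hn]
        exact (hint n a hn).choose_spec }
  exact Module.Baer.of_divisible _

/-- Characters of two subgroups that agree on the intersection have a common extension. -/
theorem exists_common_extension (ε ε' : AddSubgroup (Lattice r)) (χ : ε →+ Additive ℂˣ)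
    (χ' : ε' →+ Additive ℂˣ)
    (h : ∀ (l : Lattice r) (hl : l ∈ ε) (hl' : l ∈ ε'), χ ⟨l, hl⟩ = χ' ⟨l, hl'⟩) :
    ∃ x : Torus r, (∀ l : ε, Additive.ofMul (monomialAt l.1 x) = χ l) ∧
      ∀ l : ε', Additive.ofMul (monomialAt l.1 x) = χ' l := by
  let f : Lattice r →ₗ.[ℤ] Additive ℂˣ := ⟨ε.toIntSubmodule, χ.toIntLinearMap⟩
  let g : Lattice r →ₗ.[ℤ] Additive ℂˣ := ⟨ε'.toIntSubmodule, χ'.toIntLinearMap⟩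
  have hfg : ∀ (x : f.domain) (y : g.domain), (x : Lattice r) = y → f x = g y := by
    rintro ⟨x, hx⟩ ⟨y, hy⟩ (rfl : x = y)
    exact h x hx hy
  obtain ⟨φ, hφ⟩ := baer_units.extension_property (f.sup g hfg).domain.subtype
    (Submodule.injective_subtype _) (f.sup g hfg).toFun
  have key : ∀ l (hl : l ∈ (f.sup g hfg).domain), φ l = f.sup g hfg ⟨l, hl⟩ := fun l hl =>
    congrArg (fun ψ => ψ ⟨l, hl⟩) hφ
  have hx : ∀ l, Additive.ofMul (monomialAt l (torusEquivCharacters.symm φ.toAddMonoidHom)) = φ l := by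
    intro l
    rw [← torusEquivCharacters_apply, Equiv.apply_symm_apply]
    rfl
  refine ⟨torusEquivCharacters.symm φ.toAddMonoidHom, fun l => ?_, fun l => ?_⟩
  · have hl : l.1 ∈ (f.sup g hfg).domain := Submodule.mem_sup_left l.2
    rw [hx, key l.1 hl]
    refine (LinearPMap.sup_apply hfg ⟨l.1, l.2⟩ 0 ⟨l.1, hl⟩ (by simp)).trans ?_
    exact (congrArg (f _ + ·) g.map_zero).trans (add_zero _)
  · have hl : l.1 ∈ (f.sup g hfg).domain := Submodule.mem_sup_right l.2
    rw [hx, key l.1 hl]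
    refine (LinearPMap.sup_apply hfg 0 ⟨l.1, l.2⟩ ⟨l.1, hl⟩ (by simp)).trans ?_
    exact (congrArg (· + g _) f.map_zero).trans (zero_add _)

/-! ### Saturation -/

theorem le_saturation (ε : AddSubgroup (Lattice r)) : ε ≤ saturation ε :=
  fun l hl => ⟨1, one_pos, by simpa using hl⟩

instance finite_saturation_quotient (ε : AddSubgroup (Lattice r)) :
    Finite (saturation ε ⧸ ε.addSubgroupOf (saturation ε)) := by
  have : Module.Finite ℤ (saturation ε) :=
    inferInstanceAs (Module.Finite ℤ (saturation ε).toIntSubmodule)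
  have : AddGroup.FG (saturation ε) := Module.Finite.iff_addGroup_fg.1 this
  refine AddCommGroup.finite_of_fg_isAddTorsion _ fun q => ?_
  induction q using QuotientAddGroup.induction_on with
  | H l =>
    obtain ⟨n, hn, hl⟩ := l.2
    rw [isOfFinAddOrder_iff_nsmul_eq_zero]
    refine ⟨n, hn, ?_⟩
    rw [← QuotientAddGroup.mk_nsmul, QuotientAddGroup.eq_zero_iff]
    exact hl

/-- In a finite abelian group the exponent is attained as the order of an element, so the largest
order annihilates the whole quotient. -/
theorem torsionExponent_eq_exponent (ε : AddSubgroup (Lattice r)) :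
    torsionExponent ε =
      AddMonoid.exponent (saturation ε ⧸ ε.addSubgroupOf (saturation ε)) :=
  (AddMonoid.exponent_eq_iSup_addOrderOf fun g => addOrderOf_pos g).symm

theorem torsionExponent_pos (ε : AddSubgroup (Lattice r)) : 0 < torsionExponent ε := by
  rw [torsionExponent_eq_exponent]
  exact Nat.pos_of_ne_zero AddMonoid.exponent_ne_zero_of_finite

theorem torsionExponent_nsmul_mem {ε : AddSubgroup (Lattice r)} {l : Lattice r}
    (hl : l ∈ saturation ε) : torsionExponent ε • l ∈ ε := by
  have h := AddMonoid.exponent_nsmul_eq_zero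
    (QuotientAddGroup.mk ⟨l, hl⟩ : saturation ε ⧸ ε.addSubgroupOf (saturation ε))
  rw [← torsionExponent_eq_exponent, ← QuotientAddGroup.mk_nsmul,
    QuotientAddGroup.eq_zero_iff] at h
  exact h

theorem nsmul_mem_of_torsionExponent_dvd {ε : AddSubgroup (Lattice r)} {l : Lattice r} {D : ℕ}
    (hD : torsionExponent ε ∣ D) (hl : l ∈ saturation ε) : D • l ∈ ε := by
  obtain ⟨k, rfl⟩ := hD
  rw [mul_comm, mul_nsmul']
  exact ε.nsmul_mem (torsionExponent_nsmul_mem hl) k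

theorem finrank_mono {ε ε' : AddSubgroup (Lattice r)} (h : ε ≤ ε') :
    Module.finrank ℤ ε ≤ Module.finrank ℤ ε' := by
  have : Module.Finite ℤ ε' := inferInstanceAs (Module.Finite ℤ ε'.toIntSubmodule)
  exact LinearMap.finrank_le_finrank_of_injective
    (f := (AddSubgroup.inclusion h).toIntLinearMap) (AddSubgroup.inclusion_injective h)

/-- Multiplication by the exponent of the quotient embeds the saturation in `ε`. -/
theorem finrank_saturation (ε : AddSubgroup (Lattice r)) :
    Module.finrank ℤ (saturation ε) = Module.finrank ℤ ε := by
  refine le_antisymm ?_ (finrank_mono (le_saturation ε))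
  have : Module.Finite ℤ ε := inferInstanceAs (Module.Finite ℤ ε.toIntSubmodule)
  let f : saturation ε →+ ε :=
    { toFun := fun l => ⟨torsionExponent ε • l.1, torsionExponent_nsmul_mem l.2⟩
      map_zero' := by simp
      map_add' := fun a b => by ext1; simp }
  refine LinearMap.finrank_le_finrank_of_injective (f := f.toIntLinearMap) fun a b hab => ?_
  have h1 : torsionExponent ε • a.1 = torsionExponent ε • b.1 := congrArg Subtype.val hab
  exact Subtype.ext (smul_right_injective _ (torsionExponent_pos ε).ne' h1)

/-! ### Counting torsion points in a coset of `V(ε)` -/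

/-- Multiplication by `n` on the exponent lattice. -/
abbrev mulLattice (r n : ℕ) : Lattice r →+ Lattice r := nsmulAddMonoidHom n

/-- The elements of the saturation of `ε` that are mapped into `ε` by multiplication by `n`. -/
def divisionGroup (ε : AddSubgroup (Lattice r)) (n : ℕ) : AddSubgroup (Lattice r) :=
  ε.comap (mulLattice r n) ⊓ saturation ε

/-- The order of the `n`-torsion subgroup of the quotient of the saturation of `ε` by `ε`. -/
def torsionOrder (ε : AddSubgroup (Lattice r)) (n : ℕ) : ℕ := ε.relIndex (divisionGroup ε n)

theorem mem_divisionGroup {ε : AddSubgroup (Lattice r)} {n : ℕ} {l : Lattice r} :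
    l ∈ divisionGroup ε n ↔ n • l ∈ ε ∧ l ∈ saturation ε := Iff.rfl

/-- `D` maps the saturation into `ε`, so adding it to `n` changes no membership. For `n > 0` the
intersection with the saturation in `divisionGroup` is automatic; it matters at `n = 0`, where
periodicity must hold as well. -/
theorem torsionOrder_periodic {ε : AddSubgroup (Lattice r)} {D : ℕ}
    (hD : torsionExponent ε ∣ D) : Function.Periodic (torsionOrder ε) D := by
  intro n
  rw [torsionOrder, torsionOrder]
  congr 1
  ext l
  simp only [mem_divisionGroup]
  refine and_congr_left fun hl => ?_
  rw [add_nsmul]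
  exact ε.add_mem_cancel_right (nsmul_mem_of_torsionExponent_dvd hD hl)

theorem index_range_nsmul (M : Type*) [AddCommGroup M] [Module.Free ℤ M] [Module.Finite ℤ M]
    (n : ℕ) : (nsmulAddMonoidHom n : M →+ M).range.index = n ^ Module.finrank ℤ M := by
  let ι := Module.Free.ChooseBasisIndex ℤ M
  let e : M ≃+ (ι → ℤ) := (Module.Free.chooseBasis ℤ M).equivFun.toAddEquiv
  rw [← AddSubgroup.index_map_equiv _ e]
  have : (nsmulAddMonoidHom n : M →+ M).range.map (e : M →+ (ι → ℤ))
      = AddSubgroup.pi Set.univ fun _ => AddSubgroup.zmultiples (n : ℤ) := by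
    ext v
    simp only [AddSubgroup.mem_map, AddMonoidHom.mem_range, AddSubgroup.mem_pi, Set.mem_univ,
      forall_true_left, Int.mem_zmultiples_iff]
    constructor
    · rintro ⟨_, ⟨y, rfl⟩, rfl⟩ i
      exact ⟨e y i, by simp⟩
    · intro h
      choose w hw using h
      refine ⟨n • e.symm w, ⟨e.symm w, rfl⟩, ?_⟩
      funext i
      simp [hw i]
  rw [this, AddSubgroup.index_pi]
  simp [Module.finrank_eq_card_chooseBasisIndex, Int.index_zmultiples, ι]

theorem finrank_le_rank (ε : AddSubgroup (Lattice r)) : Module.finrank ℤ ε ≤ r := by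
  have : Module.finrank ℤ ε ≤ Module.finrank ℤ (Lattice r) :=
    Submodule.finrank_le ε.toIntSubmodule
  rwa [Module.finrank_fin_fun] at this

/-- Two index computations are compared. The index n^r of nℤ^r is [ε : ε ∩ nℤ^r] times the index
sought. The index n^(rank ε) of nε in ε is [ε : ε ∩ nℤ^r] times [ε ∩ nℤ^r : nε], and the last factor
is `torsionOrder ε n`, because multiplication by n carries `divisionGroup ε n` onto ε ∩ nℤ^r and ε
onto nε. -/
theorem index_sup_range (ε : AddSubgroup (Lattice r)) {n : ℕ} (hn : 0 < n) :
    (ε ⊔ (mulLattice r n).range).index = n ^ (r - Module.finrank ℤ ε) * torsionOrder ε n := by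
  have : Module.Free ℤ ε := inferInstanceAs (Module.Free ℤ ε.toIntSubmodule)
  have : Module.Finite ℤ ε := inferInstanceAs (Module.Finite ℤ ε.toIntSubmodule)
  have hinj : Function.Injective (mulLattice r n) := smul_right_injective _ hn.ne'
  have h1 : (mulLattice r n).range.index = n ^ r := by
    rw [index_range_nsmul]; simp
  have h2 : (mulLattice r n).range.relIndex ε * (ε ⊔ (mulLattice r n).range).index = n ^ r := by
    rw [← AddSubgroup.relIndex_sup_right, AddSubgroup.relIndex_mul_index le_sup_right, h1]
  have hmap : ε.map (mulLattice r n) ≤ ε := by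
    rintro _ ⟨l, hl, rfl⟩
    exact ε.nsmul_mem hl n
  have h3 : (ε.map (mulLattice r n)).relIndex ε = n ^ Module.finrank ℤ ε := by
    rw [← index_range_nsmul ε n, AddSubgroup.relIndex]
    congr 1
    ext l
    simp only [AddSubgroup.mem_addSubgroupOf, AddSubgroup.mem_map, AddMonoidHom.mem_range]
    constructor
    · rintro ⟨m, hm, h⟩
      exact ⟨⟨m, hm⟩, Subtype.ext h⟩
    · rintro ⟨m, rfl⟩
      exact ⟨m.1, m.2, rfl⟩
  have h4 : (divisionGroup ε n).map (mulLattice r n) = (mulLattice r n).range ⊓ ε := by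
    ext l
    simp only [AddSubgroup.mem_map, AddSubgroup.mem_inf, AddMonoidHom.mem_range,
      mem_divisionGroup]
    constructor
    · rintro ⟨m, ⟨hm, -⟩, rfl⟩
      exact ⟨⟨m, rfl⟩, hm⟩
    · rintro ⟨⟨m, rfl⟩, hm⟩
      exact ⟨m, ⟨hm, n, hn, hm⟩, rfl⟩
  have h5 : (ε.map (mulLattice r n)).relIndex ((mulLattice r n).range ⊓ ε) = torsionOrder ε n := by
    rw [← h4, AddSubgroup.relIndex_map_map_of_injective _ _ hinj]; rfl
  have h6 := AddSubgroup.relIndex_mul_relIndex (ε.map (mulLattice r n))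
    ((mulLattice r n).range ⊓ ε) ε
    (le_inf (by rintro _ ⟨l, -, rfl⟩; exact ⟨l, rfl⟩) hmap) inf_le_right
  rw [h5, h3, AddSubgroup.inf_relIndex_right] at h6
  have hρ := finrank_le_rank ε
  have hpos : 0 < n ^ Module.finrank ℤ ε := pow_pos hn _
  have hsplit : n ^ r = n ^ (r - Module.finrank ℤ ε) * n ^ Module.finrank ℤ ε := by
    rw [← pow_add, Nat.sub_add_cancel hρ]
  apply Nat.eq_of_mul_eq_mul_right hpos
  calc _ = torsionOrder ε n * ((mulLattice r n).range.relIndex ε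
        * (ε ⊔ (mulLattice r n).range).index) := by rw [← h6]; ring
    _ = _ := by rw [h2, hsplit]; ring

/-- The torsion points of order dividing `n` in `V(ε)` are the characters of
`ℤ^r / (ε + n ℤ^r)`. -/
theorem ncard_torsion_subgroupLocus (ε : AddSubgroup (Lattice r)) {n : ℕ} (hn : 0 < n) :
    Set.ncard {x : Torus r | x ^ n = 1 ∧ ∀ l ∈ ε, monomialAt l x = 1}
      = (ε ⊔ (mulLattice r n).range).index := by
  set K := ε ⊔ (mulLattice r n).range with hK
  have hfin : Finite (Lattice r ⧸ K) := by
    have h1 : (mulLattice r n).range.index ≠ 0 := by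
      rw [index_range_nsmul]; exact pow_ne_zero _ hn.ne'
    have : K.FiniteIndex :=
      ⟨fun h0 => h1 (Nat.eq_zero_of_zero_dvd
        (h0 ▸ AddSubgroup.index_dvd_of_le (le_sup_right : _ ≤ K)))⟩
    infer_instance
  have hmem : ∀ x : Torus r, (x ^ n = 1 ∧ ∀ l ∈ ε, monomialAt l x = 1) ↔
      K ≤ (torusEquivCharacters x).ker := by
    intro x
    rw [hK, sup_le_iff, and_comm, pow_eq_one_iff_monomialAt]
    refine and_congr Iff.rfl ?_
    constructor
    · rintro h _ ⟨l, rfl⟩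
      exact h l
    · intro h l
      exact h ⟨l, rfl⟩
  let E : {x : Torus r | x ^ n = 1 ∧ ∀ l ∈ ε, monomialAt l x = 1} ≃
      (Lattice r ⧸ K →+ Additive ℂˣ) :=
    { toFun := fun x => QuotientAddGroup.lift K (torusEquivCharacters x.1) ((hmem x.1).1 x.2)
      invFun := fun φ => ⟨torusEquivCharacters.symm (φ.comp (QuotientAddGroup.mk' K)), by
        refine (hmem _).2 fun l hl => ?_
        rw [Equiv.apply_symm_apply, AddMonoidHom.mem_ker]
        simp [(QuotientAddGroup.eq_zero_iff l).2 hl]⟩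
      left_inv := fun x => by
        apply Subtype.ext
        apply torusEquivCharacters.injective
        rw [Equiv.apply_symm_apply]
        rfl
      right_inv := fun φ => by
        ext l : 2
        simp }
  -- A finite abelian group has as many characters into ℂˣ as elements.
  rw [← Nat.card_coe_set_eq, Nat.card_congr E, AddSubgroup.index,
    Nat.card_congr (AddMonoidHom.toMultiplicativeLeft : _ ≃ (Multiplicative (Lattice r ⧸ K) →* ℂˣ))]
  have : NeZero (Monoid.exponent (Multiplicative (Lattice r ⧸ K))) :=
    ⟨Monoid.exponent_ne_zero_of_finite⟩
  exact CommGroup.card_monoidHom_of_hasEnoughRootsOfUnity (Multiplicative (Lattice r ⧸ K)) ℂ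

/-- The condition that the character `l ↦ η^l` of `ε` extends to a character of `ℤ^r` of order
dividing `n`. -/
def ExtendsToTorsion (ε : AddSubgroup (Lattice r)) (η : Torus r) (n : ℕ) : Prop :=
  ∀ l ∈ saturation ε, n • l ∈ ε → monomialAt (n • l) η = 1

/-- For `l` in the saturation, `D • l` lies in `ε`, where the character of `η` has order dividing
`M`. This is the source of the product `M * D` in the bound on the period. -/
theorem extendsToTorsion_periodic {ε : AddSubgroup (Lattice r)} {η : Torus r} {M D : ℕ}
    (hM : ∀ l ∈ ε, monomialAt l η ^ M = 1) (hD : torsionExponent ε ∣ D) (n : ℕ) :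
    ExtendsToTorsion ε η (n + M * D) ↔ ExtendsToTorsion ε η n := by
  refine forall₂_congr fun l hl => ?_
  have h1 := nsmul_mem_of_torsionExponent_dvd hD hl
  have h2 : (M * D) • l ∈ ε := by
    rw [mul_nsmul']; exact ε.nsmul_mem h1 M
  have h3 : monomialAt ((M * D) • l) η = 1 := by
    rw [mul_nsmul', monomialAt_nsmul, hM _ h1]
  rw [add_nsmul, ε.add_mem_cancel_right h2, monomialAt_add, h3, mul_one]

theorem extendsToTorsion_of_dvd {ε : AddSubgroup (Lattice r)} {η : Torus r} {M D n : ℕ}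
    (hM : ∀ l ∈ ε, monomialAt l η ^ M = 1) (hD : torsionExponent ε ∣ D) (hn : M * D ∣ n) :
    ExtendsToTorsion ε η n := by
  intro l hl _
  obtain ⟨k, rfl⟩ := hn
  have h1 := nsmul_mem_of_torsionExponent_dvd hD hl
  rw [mul_comm, mul_nsmul', monomialAt_nsmul, mul_nsmul', monomialAt_nsmul, hM _ h1, one_pow]

/-- An n-torsion point is a character trivial on nℤ^r. The condition says that this trivial
character and that of `η` agree on ε ∩ nℤ^r, which is all that a common extension requires. -/
theorem exists_torsion_iff (ε : AddSubgroup (Lattice r)) (η : Torus r) {n : ℕ} (hn : 0 < n) :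
    (∃ x : Torus r, x ^ n = 1 ∧ ∀ l ∈ ε, monomialAt l x = monomialAt l η) ↔
      ExtendsToTorsion ε η n := by
  constructor
  · rintro ⟨x, hx, h⟩ l - hl
    rw [← h _ hl]
    exact (pow_eq_one_iff_monomialAt x n).1 hx l
  · intro h
    obtain ⟨x, hx, hx'⟩ := exists_common_extension ε (mulLattice r n).range
      (restrictPoint ε η) 0 (by
        rintro _ hl ⟨l, rfl⟩
        exact congrArg Additive.ofMul (h l ⟨n, hn, hl⟩ hl))
    refine ⟨x, (pow_eq_one_iff_monomialAt x n).2 fun l => ?_, fun l hl => ?_⟩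
    · exact Additive.ofMul.injective (hx' ⟨n • l, l, rfl⟩)
    · exact Additive.ofMul.injective (hx ⟨l, hl⟩)

open Classical in
/-- The number of points of order dividing `n` in a coset of `V(ε)`. -/
theorem ncard_torsion_coset (ε : AddSubgroup (Lattice r)) (η : Torus r) {n : ℕ} (hn : 0 < n) :
    Set.ncard {x : Torus r | x ^ n = 1 ∧ ∀ l ∈ ε, monomialAt l x = monomialAt l η}
      = if ExtendsToTorsion ε η n then n ^ (r - Module.finrank ℤ ε) * torsionOrder ε n else 0 := by
  split_ifs with h
  · obtain ⟨y, hy, hyη⟩ := (exists_torsion_iff ε η hn).2 h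
    rw [← index_sup_range ε hn, ← ncard_torsion_subgroupLocus ε hn]
    refine Eq.trans (congrArg Set.ncard ?_) (Set.ncard_image_of_injective _ (mul_right_injective y))
    ext x
    simp only [Set.mem_ofPred_eq, Set.mem_image]
    constructor
    · rintro ⟨hx, hxη⟩
      refine ⟨y⁻¹ * x, ⟨by rw [mul_pow, inv_pow, hx, hy]; simp, fun l hl => ?_⟩, by simp⟩
      rw [monomialAt_mul, monomialAt_inv, hxη l hl, hyη l hl, inv_mul_cancel]
    · rintro ⟨z, ⟨hz, hzε⟩, rfl⟩
      refine ⟨by rw [mul_pow, hy, hz, one_mul], fun l hl => ?_⟩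
      rw [monomialAt_mul, hzε l hl, hyη l hl, mul_one]
  · rw [← exists_torsion_iff ε η hn] at h
    convert! Set.ncard_empty (Torus r)
    rw [Set.eq_empty_iff_forall_notMem]
    exact fun x hx => h ⟨x, hx⟩

theorem finite_torsion (r : ℕ) {n : ℕ} (hn : 0 < n) : {x : Torus r | x ^ n = 1}.Finite := by
  have : NeZero n := ⟨hn.ne'⟩
  have h : {x : Torus r | x ^ n = 1} = Set.pi Set.univ fun _ => (rootsOfUnity n ℂ : Set ℂˣ) := by
    ext x
    simp [funext_iff, mem_rootsOfUnity]
  rw [h]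
  refine Set.Finite.pi fun _ => ?_
  exact @Set.toFinite _ _ (inferInstanceAs (Finite (rootsOfUnity n ℂ)))

/-! ### Counting torsion points in a finite union of cosets -/

theorem monomialAt_eq_of_mem_iSup {I : Type*} {K : Finset I} {ε : I → AddSubgroup (Lattice r)}
    {x η : Torus r} (h : ∀ k ∈ K, ∀ l ∈ ε k, monomialAt l x = monomialAt l η) {l : Lattice r}
    (hl : l ∈ ⨆ k ∈ K, ε k) : monomialAt l x = monomialAt l η := by
  have hle : (⨆ k ∈ K, ε k) ≤ (torusEquivCharacters x).eqLocus (torusEquivCharacters η) :=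
    iSup₂_le fun k hk l hl => congrArg Additive.ofMul (h k hk l hl)
  exact Additive.ofMul.injective (hle hl)

/-- A family of cosets `E k` of the groups `V(ε k)`, some of them possibly empty. -/
def IsCosetFamily {I : Type*} (E : I → Set (Torus r)) (ε : I → AddSubgroup (Lattice r)) : Prop :=
  ∀ k, ∀ η ∈ E k, ∀ x, x ∈ E k ↔ ∀ l ∈ ε k, monomialAt l x = monomialAt l η

/-- A nonempty intersection of cosets is a coset for the sum of the groups, so its count is a single
term. An empty intersection gets the zero coefficient; the final clause therefore speaks of nonzero
coefficients only. -/
theorem exists_periodic_coeff_inter {I : Type*} {E : I → Set (Torus r)}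
    {ε : I → AddSubgroup (Lattice r)} (hE : IsCosetFamily E ε) {M D : ℕ}
    (hM : ∀ k, ∀ η ∈ E k, ∀ l ∈ ε k, monomialAt l η ^ M = 1) {K : Finset I}
    (hD : torsionExponent (⨆ k ∈ K, ε k) ∣ D) :
    ∃ (a : ℕ → ℚ) (d : ℕ), d ≤ r ∧ Function.Periodic a (M * D) ∧
      (∀ n, 0 < n →
        (Set.ncard {x : Torus r | x ^ n = 1 ∧ ∀ k ∈ K, x ∈ E k} : ℚ) = a n * (n : ℚ) ^ d) ∧
      (a ≠ 0 → d = r - Module.finrank ℤ (⨆ k ∈ K, ε k : AddSubgroup (Lattice r)) ∧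
        ∃ η, ∀ k ∈ K, η ∈ E k) := by
  classical
  by_cases hne : ∃ η, ∀ k ∈ K, η ∈ E k
  swap
  · refine ⟨0, 0, Nat.zero_le _, fun _ => rfl, fun n _ => ?_, fun h => absurd rfl h⟩
    have : {x : Torus r | x ^ n = 1 ∧ ∀ k ∈ K, x ∈ E k} = ∅ :=
      Set.eq_empty_iff_forall_notMem.2 fun x hx => hne ⟨x, hx.2⟩
    simp [this]
  obtain ⟨η, hη⟩ := hne
  set ε' := ⨆ k ∈ K, ε k with hε'
  have hM' : ∀ l ∈ ε', monomialAt l η ^ M = 1 := by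
    intro l hl
    rw [← monomialAt_pow, ← monomialAt_one l]
    refine monomialAt_eq_of_mem_iSup (fun k hk m hm => ?_) hl
    rw [monomialAt_pow, monomialAt_one, hM k η (hη k hk) m hm]
  refine ⟨fun n => if ExtendsToTorsion ε' η n then (torsionOrder ε' n : ℚ) else 0,
    r - Module.finrank ℤ ε', Nat.sub_le _ _, fun n => ?_, fun n hn => ?_, fun _ => ⟨rfl, η, hη⟩⟩
  · have h1 : torsionOrder ε' (n + M * D) = torsionOrder ε' n :=
      torsionOrder_periodic (hD.mul_left M) n
    simp only [extendsToTorsion_periodic hM' hD n, h1]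
  · have hset : {x : Torus r | x ^ n = 1 ∧ ∀ k ∈ K, x ∈ E k}
        = {x | x ^ n = 1 ∧ ∀ l ∈ ε', monomialAt l x = monomialAt l η} := by
      ext x
      refine and_congr_right fun _ => ⟨fun h l hl => ?_, fun h k hk => ?_⟩
      · exact monomialAt_eq_of_mem_iSup (fun k hk => (hE k η (hη k hk) x).1 (h k hk)) hl
      · exact (hE k η (hη k hk) x).2 fun l hl =>
          h l ((le_iSup₂ (f := fun k (_ : k ∈ K) => ε k) k hk) hl)
    rw [hset, ncard_torsion_coset ε' η hn]
    by_cases h : ExtendsToTorsion ε' η n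
    · simp only [if_pos h]; push_cast; ring
    · simp [h]

/-- Inclusion-exclusion, with the terms of equal degree collected. A larger sum of groups has larger
rank, so intersections never exceed the degree of the cosets they lie in. -/
theorem exists_periodicCoeffs_iUnion {I : Type*} [Finite I] {E : I → Set (Torus r)}
    {ε : I → AddSubgroup (Lattice r)} (hE : IsCosetFamily E ε) {M D : ℕ}
    (hMpos : 0 < M) (hDpos : 0 < D)
    (hM : ∀ k, ∀ η ∈ E k, ∀ l ∈ ε k, monomialAt l η ^ M = 1)
    (hD : ∀ K : Finset I, torsionExponent (⨆ k ∈ K, ε k) ∣ D) :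
    ∃ a : ℕ → ℕ → ℚ, IsPeriodicCoeffs (torsionCount (⋃ k, E k)) a ∧
      (∀ i, Function.Periodic (a i) (M * D)) ∧
      ∀ i, a i ≠ 0 → ∃ k, (E k).Nonempty ∧ i ≤ r - Module.finrank ℤ (ε k) := by
  classical
  have := Fintype.ofFinite I
  choose a d hd hper hcount hne using fun K : Finset I =>
    exists_periodic_coeff_inter hE hM (hD K)
  let T := (Finset.univ : Finset I).powerset.filter (·.Nonempty)
  let c : ℕ → ℕ → ℚ := fun i n => ∑ K ∈ T, if d K = i then (-1 : ℚ) ^ (K.card + 1) * a K n else 0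
  have hcper : ∀ i, Function.Periodic (c i) (M * D) := by
    intro i n
    refine Finset.sum_congr rfl fun K _ => ?_
    rw [hper K n]
  refine ⟨c, ⟨fun i => ⟨M * D, Nat.mul_pos hMpos hDpos, hcper i⟩, r, fun i hi => ?_, fun n hn => ?_⟩,
    hcper, fun i hi => ?_⟩
  · funext n
    refine Finset.sum_eq_zero fun K _ => if_neg ?_
    have := hd K
    omega
  · have hfin : ∀ k, {x | x ^ n = 1 ∧ x ∈ E k}.Finite := fun k =>
      (finite_torsion r hn).subset fun x hx => hx.1
    let S : I → Finset (Torus r) := fun k => (hfin k).toFinset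
    have h1 : torsionCount (⋃ k, E k) n = (Finset.univ.biUnion S).card := by
      rw [torsionCount, ← Set.ncard_coe_finset]
      congr 1
      ext x
      simp only [S, Set.mem_ofPred_eq, Set.mem_iUnion, Finset.coe_biUnion, Set.Finite.coe_toFinset,
        Finset.coe_univ, Set.mem_univ, Set.iUnion_true]
      tauto
    have h2 : ∀ (K : Finset I) (hK : K.Nonempty),
        ((K.inf' hK S).card : ℚ) = a K n * (n : ℚ) ^ d K := by
      intro K hK
      rw [← hcount K n hn, ← Set.ncard_coe_finset]
      congr 2
      ext x
      obtain ⟨k₀, hk₀⟩ := id hK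
      simp only [Finset.mem_coe, Finset.mem_inf', S, Set.Finite.mem_toFinset, Set.mem_ofPred_eq]
      exact ⟨fun h => ⟨(h k₀ hk₀).1, fun k hk => (h k hk).2⟩, fun h k hk => ⟨h.1, h.2 k hk⟩⟩
    have h3 := congrArg (Int.cast : ℤ → ℚ)
      (Finset.inclusion_exclusion_card_biUnion (Finset.univ : Finset I) S)
    rw [h1]
    rw [Int.cast_natCast] at h3
    rw [h3]
    push_cast
    rw [Finset.sum_congr rfl fun K _ => by rw [h2 K.1 (Finset.mem_filter.1 K.2).2]]
    rw [Finset.sum_coe_sort T fun K => (-1 : ℚ) ^ (K.card + 1) * (a K n * (n : ℚ) ^ d K)]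
    simp only [c, Finset.sum_mul]
    rw [Finset.sum_comm]
    refine Finset.sum_congr rfl fun K _ => ?_
    rw [Finset.sum_eq_single_of_mem (d K) (Finset.mem_range.2 (Nat.lt_succ_of_le (hd K)))]
    · rw [if_pos rfl]; ring
    · intro i _ hi
      rw [if_neg hi.symm, zero_mul]
  · obtain ⟨n, hn⟩ := Function.ne_iff.1 hi
    obtain ⟨K, hKT, hK⟩ := Finset.exists_ne_zero_of_sum_ne_zero hn
    have hdi : d K = i := by
      by_contra h
      exact hK (if_neg h)
    have ha : a K ≠ 0 := fun h => hK (by simp [h])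
    obtain ⟨hdK, η, hη⟩ := hne K ha
    obtain ⟨k, hk⟩ := (Finset.mem_filter.1 hKT).2
    refine ⟨k, ⟨η, hη k hk⟩, ?_⟩
    rw [← hdi, hdK]
    exact Nat.sub_le_sub_left (finrank_mono (le_iSup₂ (f := fun k (_ : k ∈ K) => ε k) k hk)) r

/-- Every nonempty coset contains many torsion points. -/
theorem pow_le_torsionCount {V E : Set (Torus r)} (hEV : E ⊆ V) {ε : AddSubgroup (Lattice r)}
    {η : Torus r} (hE : ∀ x, x ∈ E ↔ ∀ l ∈ ε, monomialAt l x = monomialAt l η) {M D n : ℕ}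
    (hM : ∀ l ∈ ε, monomialAt l η ^ M = 1) (hD : torsionExponent ε ∣ D) (hn : 0 < n)
    (hdvd : M * D ∣ n) : n ^ (r - Module.finrank ℤ ε) ≤ torsionCount V n := by
  have hext := extendsToTorsion_of_dvd hM hD hdvd
  have h1 : Set.ncard {x : Torus r | x ^ n = 1 ∧ ∀ l ∈ ε, monomialAt l x = monomialAt l η}
      ≤ torsionCount V n :=
    Set.ncard_le_ncard (fun x hx => ⟨hEV ((hE x).2 hx.2), hx.1⟩)
      ((finite_torsion r hn).subset fun x hx => hx.2)
  -- An index could be 0 by convention; the existence of one torsion point in the coset excludes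
  -- this.
  have h2 : 0 < torsionOrder ε n := by
    refine Nat.pos_of_ne_zero fun h0 => ?_
    obtain ⟨y, hy⟩ := (exists_torsion_iff ε η hn).2 hext
    have h3 : Set.ncard {x : Torus r | x ^ n = 1 ∧ ∀ l ∈ ε, monomialAt l x = monomialAt l η} = 0 := by
      rw [ncard_torsion_coset ε η hn, if_pos hext, h0, mul_zero]
    rw [Set.ncard_eq_zero ((finite_torsion r hn).subset fun x hx => hx.1)] at h3
    exact Set.notMem_empty y (h3 ▸ hy)
  rw [ncard_torsion_coset ε η hn, if_pos hext] at h1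
  exact (Nat.le_mul_of_pos_right _ h2).trans h1

/-! ### Partitions with vanishing block sums -/

theorem coeff_ne_zero {f : Laurent r} {l : Lattice r} (hl : l ∈ exponents f) : f.coeff l ≠ 0 :=
  Finsupp.mem_support_iff.1 hl

/-- The classes of a function on a finite set form a partition. -/
theorem exists_finpartition_classes {α X : Type*} [DecidableEq α] [DecidableEq X] (s : Finset α)
    (φ : α → X) :
    ∃ P : Finpartition s, ∀ ν ∈ P.parts, ∃ l ∈ s, ν = s.filter fun m => φ m = φ l := by
  refine ⟨Finpartition.ofExistsUnique (s.image fun l => s.filter fun m => φ m = φ l) ?_ ?_ ?_, ?_⟩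
  · intro p hp
    obtain ⟨l, -, rfl⟩ := Finset.mem_image.1 hp
    exact Finset.filter_subset _ _
  · intro a ha
    refine ⟨s.filter fun m => φ m = φ a, ⟨Finset.mem_image_of_mem _ ha, by simp [ha]⟩, ?_⟩
    rintro t ⟨ht, hat⟩
    obtain ⟨l, -, rfl⟩ := Finset.mem_image.1 ht
    rw [(Finset.mem_filter.1 hat).2]
  · intro h
    obtain ⟨l, hl, h0⟩ := Finset.mem_image.1 h
    have : l ∈ s.filter fun m => φ m = φ l := by simp [hl]
    rw [h0] at this
    exact Finset.notMem_empty _ this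
  · intro ν hν
    obtain ⟨l, hl, rfl⟩ := Finset.mem_image.1 hν
    exact ⟨l, hl, rfl⟩

/-- If the sums of nonzero terms over all classes of `φ` vanish, then these classes form a
partition all of whose blocks have at least two elements. -/
theorem exists_partition_of_classes {f : Laurent r} {X : Type*} [DecidableEq X] (φ : Lattice r → X)
    (g : Lattice r → ℂ) (hg : ∀ l ∈ exponents f, g l ≠ 0)
    (h : ∀ l ∈ exponents f, ∑ m ∈ exponents f with φ m = φ l, g m = 0) :
    ∃ P : Partitions f, ∀ ν ∈ P.1.parts, ∃ l ∈ exponents f,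
      ν = (exponents f).filter fun m => φ m = φ l := by
  obtain ⟨P, hparts⟩ := exists_finpartition_classes (exponents f) φ
  refine ⟨⟨P, fun ν hν => ?_⟩, hparts⟩
  obtain ⟨l, hl, rfl⟩ := hparts ν hν
  by_contra! hlt
  have hmem : l ∈ (exponents f).filter fun m => φ m = φ l := by simp [hl]
  have hsingle : ((exponents f).filter fun m => φ m = φ l) = {l} := by
    refine (Finset.card_le_one_iff_subset_singleton.1 (Nat.le_of_lt_succ hlt)).elim fun a ha => ?_
    have := Finset.mem_singleton.1 (ha hmem)
    subst this
    exact Finset.Subset.antisymm ha (Finset.singleton_subset_iff.2 hmem)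
  have := h l hl
  rw [hsingle, Finset.sum_singleton] at this
  exact hg l hl this

theorem sum_parts {f : Laurent r} (P : Partitions f) (g : Lattice r → ℂ) :
    ∑ l ∈ exponents f, g l = ∑ ν ∈ P.1.parts, ∑ l ∈ ν, g l := by
  conv_lhs => rw [← P.1.biUnion_parts]
  rw [Finset.sum_biUnion P.1.supIndep.pairwiseDisjoint]
  rfl

theorem base_mem {f : Laurent r} (P : Partitions f) {ν : Finset (Lattice r)}
    (hν : ν ∈ P.1.parts) : base ν ∈ ν := by
  have h := P.1.nonempty_of_mem_parts hν
  rw [base, dif_pos h]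
  exact h.choose_spec

theorem quotientMap_mem_inhomSolutions {f : Laurent r} (P : Partitions f) (e : Lattice r → ℂˣ) :
    quotientMap P e ∈ inhomSolutions P ↔ e ∈ homSolutions P := by
  have key : ∀ ν (hν : ν ∈ P.1.parts),
      (∑ l : {l // l ∈ ν.erase (base ν)}, (-f.coeff l.1 / f.coeff (base ν)) *
        (((e l.1 / e (base ν) : ℂˣ)) : ℂ) = 1 ↔ ∑ l ∈ ν, f.coeff l * (e l : ℂ) = 0) := by
    intro ν hν
    have hb := base_mem P hν
    have ha : f.coeff (base ν) ≠ 0 := coeff_ne_zero (P.1.subset hν hb)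
    have he : (e (base ν) : ℂ) ≠ 0 := (e (base ν)).ne_zero
    have h1 : ∑ l : {l // l ∈ ν.erase (base ν)}, (-f.coeff l.1 / f.coeff (base ν)) *
        (((e l.1 / e (base ν) : ℂˣ)) : ℂ)
        = -(∑ l ∈ ν.erase (base ν), f.coeff l * (e l : ℂ)) / (f.coeff (base ν) * e (base ν)) := by
      rw [Finset.sum_coe_sort (ν.erase (base ν)) fun l => (-f.coeff l / f.coeff (base ν)) *
        (((e l / e (base ν) : ℂˣ)) : ℂ), ← Finset.sum_neg_distrib, Finset.sum_div]
      refine Finset.sum_congr rfl fun l _ => ?_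
      rw [Units.val_div_eq_div_val]
      field_simp
    rw [h1, div_eq_one_iff_eq (mul_ne_zero ha he), ← Finset.add_sum_erase ν _ hb]
    constructor
    · intro h; rw [← h]; ring
    · intro h; linear_combination -h
  constructor
  · intro h ν hν
    exact (key ν hν).1 (h ⟨ν, hν⟩)
  · intro h ν
    exact (key ν.1 ν.2).2 (h ν.1 ν.2)

theorem psi_eq_quotientMap {f : Laurent r} (P : Partitions f) (x : Torus r) :
    psi P x = quotientMap P fun l => monomialAt l x := by
  funext ν l
  exact monomialAt_sub _ _ _

/-- Supplies homogeneous coordinates with value 1 at each base point, the normalization under which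
orders of nondegenerate solutions are bounded. -/
theorem exists_normalized_preimage {f : Laurent r} (P : Partitions f) (x : ReducedTorus P) :
    ∃ e : Lattice r → ℂˣ, quotientMap P e = x ∧ (∀ ν ∈ P.1.parts, e (base ν) = 1) ∧
      ∀ ν l, e l.1 = x ν l := by
  classical
  let e : Lattice r → ℂˣ := fun l =>
    if h : ∃ ν : {ν // ν ∈ P.1.parts}, l ∈ ν.1.erase (base ν.1) then x h.choose ⟨l, h.choose_spec⟩
    else 1
  have hb : ∀ ν ∈ P.1.parts, e (base ν) = 1 := by
    intro ν hν
    refine dif_neg ?_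
    rintro ⟨ν', hν'⟩
    have h1 := P.1.eq_of_mem_parts hν ν'.2 (base_mem P hν) (Finset.mem_of_mem_erase hν')
    exact Finset.ne_of_mem_erase hν' (by rw [h1])
  have hl : ∀ (ν : {ν // ν ∈ P.1.parts}) (l : {l // l ∈ ν.1.erase (base ν.1)}),
      e l.1 = x ν l := by
    rintro ν ⟨l, hl⟩
    have h : ∃ ν : {ν // ν ∈ P.1.parts}, l ∈ ν.1.erase (base ν.1) := ⟨ν, hl⟩
    have hcongr : ∀ (ν' : {ν // ν ∈ P.1.parts}) (hl' : l ∈ ν'.1.erase (base ν'.1)), ν' = ν →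
        x ν' ⟨l, hl'⟩ = x ν ⟨l, hl⟩ := by
      rintro _ _ rfl; rfl
    refine (dif_pos h).trans (hcongr _ h.choose_spec (Subtype.ext ?_))
    exact P.1.eq_of_mem_parts h.choose.2 ν.2 (Finset.mem_of_mem_erase h.choose_spec)
      (Finset.mem_of_mem_erase hl)
  refine ⟨e, ?_, hb, hl⟩
  funext ν l
  rw [quotientMap, hb ν.1 ν.2, div_one, hl]

/-- If part of a block sum vanishes, then there is a proper refinement with vanishing block
sums. -/
theorem exists_refinement {f : Laurent r} (P : Partitions f) {e : Lattice r → ℂˣ}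
    (he : e ∈ homSolutions P) {ν T : Finset (Lattice r)} (hν : ν ∈ P.1.parts) (hT : T ⊆ ν)
    (hTne : T.Nonempty) (hTν : T ≠ ν) (hsum : ∑ l ∈ T, f.coeff l * (e l : ℂ) = 0) :
    ∃ P' : Partitions f, P'.1 < P.1 ∧ e ∈ homSolutions P' := by
  classical
  -- The classes of `φ` are the blocks of `P`, except that `ν` is cut into `T` and its complement.
  let φ : Lattice r → Finset (Lattice r) × Prop := fun l => (P.1.part l, l ∈ T)
  have hφ : ∀ l m, φ m = φ l ↔ P.1.part m = P.1.part l ∧ (m ∈ T ↔ l ∈ T) := by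
    intro l m
    simp only [φ, Prod.mk.injEq, eq_iff_iff]
  have hclass : ∀ l ∈ exponents f,
      (exponents f).filter (fun m => φ m = φ l) = T ∨
      (exponents f).filter (fun m => φ m = φ l) = P.1.part l \ T := by
    intro l hl
    by_cases hlT : l ∈ T
    · left
      ext m
      rw [Finset.mem_filter, hφ]
      constructor
      · exact fun h => h.2.2.2 hlT
      · intro hm
        refine ⟨P.1.subset hν (hT hm), ?_, by tauto⟩
        rw [P.1.part_eq_of_mem hν (hT hm), P.1.part_eq_of_mem hν (hT hlT)]
    · right
      ext m
      rw [Finset.mem_filter, hφ, Finset.mem_sdiff]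
      constructor
      · rintro ⟨hm, h1, h2⟩
        exact ⟨(P.1.mem_part_iff_part_eq_part hm hl).2 h1, by tauto⟩
      · rintro ⟨h1, h2⟩
        have hm := P.1.part_subset l h1
        exact ⟨hm, (P.1.mem_part_iff_part_eq_part hm hl).1 h1, by tauto⟩
  have hzero : ∀ l ∈ exponents f,
      ∑ m ∈ exponents f with φ m = φ l, f.coeff m * (e m : ℂ) = 0 := by
    intro l hl
    rcases hclass l hl with h | h <;> rw [h]
    · exact hsum
    · have hpart := P.1.part_mem.2 hl
      have h0 := he _ hpart
      rw [← Finset.sum_inter_add_sum_sdiff (P.1.part l) T] at h0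
      suffices h1 : ∑ m ∈ P.1.part l ∩ T, f.coeff m * (e m : ℂ) = 0 by
        rwa [h1, zero_add] at h0
      by_cases hpν : P.1.part l = ν
      · rw [hpν, Finset.inter_eq_right.2 hT, hsum]
      · have hdisj : Disjoint (P.1.part l) T := (P.1.disjoint hpart hν hpν).mono_right hT
        rw [Finset.disjoint_iff_inter_eq_empty.1 hdisj, Finset.sum_empty]
  obtain ⟨P', hP'⟩ := exists_partition_of_classes φ (fun l => f.coeff l * (e l : ℂ))
    (fun l hl => mul_ne_zero (coeff_ne_zero hl) (e l).ne_zero) hzero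
  refine ⟨P', lt_of_le_of_ne ?_ ?_, ?_⟩
  · intro ν' hν'
    obtain ⟨l, hl, rfl⟩ := hP' ν' hν'
    refine ⟨P.1.part l, P.1.part_mem.2 hl, fun m hm => ?_⟩
    rw [Finset.mem_filter, hφ] at hm
    exact (P.1.mem_part_iff_part_eq_part hm.1 hl).2 hm.2.1
  · intro heq
    rw [← heq] at hν
    obtain ⟨l, hl, hlν⟩ := hP' ν hν
    refine hTν (Finset.Subset.antisymm hT fun m hm => ?_)
    obtain ⟨t, ht⟩ := hTne
    have h1 := hT ht
    rw [hlν, Finset.mem_filter, hφ] at h1 hm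
    tauto
  · intro ν' hν'
    obtain ⟨l, hl, rfl⟩ := hP' ν' hν'
    exact hzero l hl

/-! ### Finiteness of the sets of torsion solutions -/

/-- Maximality is nondegeneracy within each block: a vanishing proper subsum would give a proper
refinement. Hence all coordinates are roots of unity of order dividing the product of the bounds for
the blocks. -/
theorem finite_torsionSolutions {f : Laurent r} (P : Partitions f) :
    (torsionSolutions P).Finite := by
  classical
  choose B hB0 hB using fun ν : Finset (Lattice r) => exists_bound_nondegenerate ν fun l => f.coeff l
  let N := ∏ ν ∈ P.1.parts, B ν
  have hN : 0 < N := Finset.prod_pos fun ν _ => hB0 ν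
  have : NeZero N := ⟨hN.ne'⟩
  have hfin : {x : ReducedTorus P | ∀ ν l, x ν l ∈ rootsOfUnity N ℂ}.Finite := by
    have h : {x : ReducedTorus P | ∀ ν l, x ν l ∈ rootsOfUnity N ℂ}
        = Set.pi Set.univ fun _ => Set.pi Set.univ fun _ => (rootsOfUnity N ℂ : Set ℂˣ) := by
      ext x; simp
    rw [h]
    refine Set.Finite.pi fun _ => Set.Finite.pi fun _ => ?_
    exact @Set.toFinite _ _ (inferInstanceAs (Finite (rootsOfUnity N ℂ)))
  refine hfin.subset ?_
  rintro x ⟨⟨hx, hmax⟩, htor⟩ ν l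
  obtain ⟨e, he, hbase, hel⟩ := exists_normalized_preimage P x
  have hhom : e ∈ homSolutions P := by
    rw [← quotientMap_mem_inhomSolutions, he]; exact hx
  obtain ⟨n, hn, hxn⟩ := isOfFinOrder_iff_pow_eq_one.1 htor
  have htors : ∀ m ∈ ν.1, (e m : ℂ) ∈ torsionNumbers := by
    intro m hm
    refine ⟨n, hn, ?_⟩
    rw [← Units.val_pow_eq_pow_val, Units.val_eq_one]
    by_cases hmb : m = base ν.1
    · rw [hmb, hbase ν.1 ν.2, one_pow]
    · have := congrFun (congrFun hxn ν) ⟨m, Finset.mem_erase.2 ⟨hmb, hm⟩⟩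
      rw [hel ν ⟨m, Finset.mem_erase.2 ⟨hmb, hm⟩⟩]
      exact this
  have hroot := hB ν.1 (fun m => (e m : ℂ)) htors
    ⟨base ν.1, base_mem P ν.2, by rw [hbase ν.1 ν.2]; rfl⟩ (hhom ν.1 ν.2)
    (fun T hT hTne hsum => by
      by_contra hTν
      obtain ⟨P', hlt, hP'⟩ := exists_refinement P hhom ν.2 hT hTne hTν hsum
      exact hmax P' hlt ⟨e, hP', he⟩)
    l.1 (Finset.mem_of_mem_erase l.2)
  rw [← hel, mem_rootsOfUnity]
  obtain ⟨q, hq⟩ := Finset.dvd_prod_of_mem B ν.2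
  ext
  rw [show N = B ν.1 * q from hq, pow_mul]
  push_cast
  rw [hroot, one_pow]

/-! ### Points of `V` over solutions of the systems of equations -/

/-- The differences from the base points generate `diffGroup P`; so the fibres of `psi P` are cosets
of V(ε). -/
theorem psi_eq_psi_iff {f : Laurent r} (P : Partitions f) (x y : Torus r) :
    psi P x = psi P y ↔ ∀ l ∈ diffGroup P, monomialAt l x = monomialAt l y := by
  constructor
  · intro h l hl
    have hle : diffGroup P ≤ (torusEquivCharacters x).eqLocus (torusEquivCharacters y) := by
      have hbase : ∀ ν (hν : ν ∈ P.1.parts), ∀ m ∈ ν,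
          monomialAt (m - base ν) x = monomialAt (m - base ν) y := by
        intro ν hν m hm
        by_cases hmb : m = base ν
        · rw [hmb, sub_self, monomialAt_zero, monomialAt_zero]
        · exact congrFun (congrFun h ⟨ν, hν⟩) ⟨m, Finset.mem_erase.2 ⟨hmb, hm⟩⟩
      refine (AddSubgroup.closure_le _).2 ?_
      rintro _ ⟨ν, hν, l, hl, m, hm, rfl⟩
      refine congrArg Additive.ofMul ?_
      rw [← sub_sub_sub_cancel_right l m (base ν), monomialAt_sub, monomialAt_sub _ _ y,
        hbase ν hν l hl, hbase ν hν m hm]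
    exact Additive.ofMul.injective (hle hl)
  · intro h
    funext ν l
    exact h _ (AddSubgroup.subset_closure
      ⟨ν.1, ν.2, l.1, Finset.mem_of_mem_erase l.2, base ν.1, base_mem P ν.2, rfl⟩)

theorem evalAt_eq_zero_of_psi_mem {f : Laurent r} {P : Partitions f} {x : Torus r}
    (h : psi P x ∈ inhomSolutions P) : evalAt f x = 0 := by
  rw [psi_eq_quotientMap, quotientMap_mem_inhomSolutions] at h
  rw [evalAt, sum_parts P]
  exact Finset.sum_eq_zero fun ν hν => h ν hν

/-- A minimal partition with vanishing block sums works. A solution `e'` of a refinement with the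
same quotients differs from the monomials of `x` by a factor constant on each block of `P`, so these
monomials would solve the refinement themselves. -/
theorem exists_psi_mem_maximalSolutions {f : Laurent r} {x : Torus r} (hx : evalAt f x = 0) :
    ∃ P : Partitions f, psi P x ∈ maximalSolutions P := by
  classical
  let e : Lattice r → ℂˣ := fun l => monomialAt l x
  have hne : ∃ P : Partitions f, e ∈ homSolutions P := by
    obtain ⟨P, hP⟩ := exists_partition_of_classes (f := f) (fun _ => ()) (fun l => f.coeff l * (e l : ℂ))
      (fun l hl => mul_ne_zero (coeff_ne_zero hl) (e l).ne_zero)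
      (fun l _ => by simpa [evalAt, e] using hx)
    refine ⟨P, fun ν hν => ?_⟩
    obtain ⟨l, -, rfl⟩ := hP ν hν
    simpa [evalAt, e] using hx
  obtain ⟨P, hP⟩ := exists_minimal_of_wellFoundedLT (fun P : Partitions f => e ∈ homSolutions P) hne
  refine ⟨P, ?_, ?_⟩
  · rw [psi_eq_quotientMap, quotientMap_mem_inhomSolutions]
    exact hP.prop
  · rintro P' hlt ⟨e', he', heq⟩
    have hbase : ∀ ν (hν : ν ∈ P.1.parts), ∀ l ∈ ν, e' l = e' (base ν) / e (base ν) * e l := by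
      intro ν hν l hl
      by_cases hlb : l = base ν
      · rw [hlb, div_mul_cancel]
      · have h1 := congrFun (congrFun heq ⟨ν, hν⟩) ⟨l, Finset.mem_erase.2 ⟨hlb, hl⟩⟩
        rw [psi_eq_quotientMap] at h1
        change e' l / e' (base ν) = e l / e (base ν) at h1
        rw [div_eq_iff_eq_mul] at h1
        rw [h1, div_mul_eq_mul_div, div_mul_eq_mul_div, mul_comm]
    refine hP.not_prop_of_lt (show P' < P from hlt) fun ν' hν' => ?_
    obtain ⟨ν, hν, hsub⟩ := hlt.le hν'
    have h0 := he' ν' hν'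
    rw [Finset.sum_congr rfl fun l hl => by rw [hbase ν hν l (hsub hl)]] at h0
    push_cast at h0
    rw [Finset.sum_congr rfl fun l _ => mul_left_comm (f.coeff l) _ _, ← Finset.mul_sum] at h0
    refine (mul_eq_zero.1 h0).resolve_left ?_
    rw [← Units.val_div_eq_div_val]
    exact Units.ne_zero _

/-! ### Affine subtori and rational planes -/

theorem evalAt_eq_sum (f : Laurent r) (x : Torus r) :
    evalAt f x = f.coeff.sum fun l a => a * (monomialAt l x : ℂ) := rfl

theorem evalAt_add (f g : Laurent r) (x : Torus r) :
    evalAt (f + g) x = evalAt f x + evalAt g x := by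
  simp only [evalAt_eq_sum]
  rw [AddMonoidAlgebra.coeff_add]
  exact Finsupp.sum_add_index' (by simp) fun _ _ _ => add_mul _ _ _

theorem evalAt_zero (x : Torus r) : evalAt (0 : Laurent r) x = 0 := by
  simp [evalAt_eq_sum]

theorem evalAt_single (l : Lattice r) (a : ℂ) (x : Torus r) :
    evalAt (AddMonoidAlgebra.single l a) x = a * (monomialAt l x : ℂ) := by
  rw [evalAt_eq_sum, AddMonoidAlgebra.coeff_single]
  exact Finsupp.sum_single_index (by simp)

theorem evalAt_sum {ι : Type*} (s : Finset ι) (f : ι → Laurent r) (x : Torus r) :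
    evalAt (∑ i ∈ s, f i) x = ∑ i ∈ s, evalAt (f i) x := by
  classical
  induction s using Finset.induction_on with
  | empty => simp [evalAt_zero]
  | insert i s hi ih => rw [Finset.sum_insert hi, Finset.sum_insert hi, evalAt_add, ih]

theorem IsAlgebraic.inter {A B : Set (Torus r)} (hA : IsAlgebraic A) (hB : IsAlgebraic B) :
    IsAlgebraic (A ∩ B) := by
  obtain ⟨G, rfl⟩ := hA
  obtain ⟨H, rfl⟩ := hB
  refine ⟨G ∪ H, ?_⟩
  ext x
  simp only [zeroLocus, Set.mem_inter_iff, Set.mem_ofPred_eq, Set.mem_union]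
  exact ⟨fun h f hf => hf.elim (h.1 f) (h.2 f),
    fun h => ⟨fun f hf => h f (Or.inl hf), fun f hf => h f (Or.inr hf)⟩⟩

theorem isAlgebraic_subgroupLocus (ε : AddSubgroup (Lattice r)) :
    IsAlgebraic (subgroupLocus ε) := by
  refine ⟨(fun l => AddMonoidAlgebra.single l 1 + AddMonoidAlgebra.single 0 (-1)) '' (ε : Set _), ?_⟩
  ext x
  simp only [subgroupLocus, zeroLocus, Set.mem_ofPred_eq, Set.forall_mem_image, evalAt_add,
    evalAt_single, monomialAt_zero, SetLike.mem_coe]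
  refine forall₂_congr fun l _ => ?_
  rw [← Units.val_eq_one]
  constructor
  · intro h; rw [h]; simp
  · intro h
    push_cast at h
    linear_combination h

theorem isAlgebraic_geom_sum (l : Lattice r) (n : ℕ) :
    IsAlgebraic {x : Torus r | ∑ j ∈ Finset.range n, (monomialAt l x : ℂ) ^ j = 0} := by
  refine ⟨{∑ j ∈ Finset.range n, AddMonoidAlgebra.single (j • l) 1}, ?_⟩
  ext x
  simp only [zeroLocus, Set.mem_ofPred_eq, Set.mem_singleton_iff, forall_eq, evalAt_sum,
    evalAt_single, monomialAt_nsmul, one_mul, Units.val_pow_eq_pow_val]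

/-- A connected algebraic subgroup of `V(ε)` is contained in `V` of the saturation of `ε`. -/
theorem IsAffineSubtorus.subset_saturation {P : Subgroup (Torus r)} (hP : IsAffineSubtorus P)
    {ε : AddSubgroup (Lattice r)} (hPε : (P : Set (Torus r)) ⊆ subgroupLocus ε) :
    (P : Set (Torus r)) ⊆ subgroupLocus (saturation ε) := by
  intro p hp l ⟨n, hn, hl⟩
  -- Factoring `t ^ n - 1` at `t = x^l` splits `P` into two disjoint closed pieces, since the
  -- geometric sum equals `n ≠ 0` where `x^l = 1`. The identity lies in `A`, so `B` is empty.
  let A : Set (Torus r) := P ∩ subgroupLocus (AddSubgroup.zmultiples l)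
  let B : Set (Torus r) :=
    P ∩ {x : Torus r | ∑ j ∈ Finset.range n, (monomialAt l x : ℂ) ^ j = 0}
  have hA : ∀ x ∈ P, monomialAt l x = 1 → x ∈ A := by
    refine fun x hx h => ⟨hx, fun m hm => ?_⟩
    have hle : AddSubgroup.zmultiples l ≤ (torusEquivCharacters x).ker := by
      rw [AddSubgroup.zmultiples_le]
      exact congrArg Additive.ofMul h
    exact Additive.ofMul.injective (hle hm)
  have hA' : ∀ x ∈ A, monomialAt l x = 1 := fun x hx => hx.2 l (AddSubgroup.mem_zmultiples l)
  have hunion : (P : Set (Torus r)) = A ∪ B := by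
    refine Set.Subset.antisymm (fun x hx => ?_)
      (Set.union_subset Set.inter_subset_left Set.inter_subset_left)
    by_cases h : monomialAt l x = 1
    · exact Or.inl (hA x hx h)
    · refine Or.inr ⟨hx, ?_⟩
      have h1 := hPε hx _ hl
      rw [monomialAt_nsmul] at h1
      have h2 : (monomialAt l x : ℂ) ≠ 1 := fun h' => h (Units.ext h')
      rw [Set.mem_ofPred_eq, geom_sum_eq h2, ← Units.val_pow_eq_pow_val, h1]
      simp
  have hdisj : Disjoint A B := by
    rw [Set.disjoint_left]
    intro x hx hxB
    have h1 := hxB.2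
    rw [Set.mem_ofPred_eq, hA' x hx] at h1
    simp at h1
    omega
  rcases hP.2 A B (hP.1.inter (isAlgebraic_subgroupLocus _)) (hP.1.inter (isAlgebraic_geom_sum l n))
    hunion hdisj with h | h
  · exact absurd (hA 1 P.one_mem (monomialAt_one l)) (h ▸ Set.notMem_empty _)
  · rw [hunion, h, Set.union_empty] at hp
    exact hA' p hp

/-- `V(ε)` as a subgroup of the torus. -/
def locusSubgroup (ε : AddSubgroup (Lattice r)) : Subgroup (Torus r) where
  carrier := subgroupLocus ε
  one_mem' := fun l _ => monomialAt_one l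
  mul_mem' := fun {x y} hx hy l hl => by rw [monomialAt_mul, hx l hl, hy l hl, one_mul]
  inv_mem' := fun {x} hx l hl => by rw [monomialAt_inv, hx l hl, inv_one]

/-- The exponential map from the additive to the multiplicative group. -/
def expHom : ℂ →+ Additive ℂˣ where
  toFun z := Additive.ofMul (Units.mk0 (Complex.exp z) (Complex.exp_ne_zero z))
  map_zero' := by
    apply Additive.toMul.injective
    ext
    simp
  map_add' z w := by
    apply Additive.toMul.injective
    ext
    simp [Complex.exp_add]

theorem expHom_surjective : Function.Surjective expHom := by
  intro u
  refine ⟨Complex.log (u.toMul : ℂˣ), ?_⟩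
  apply Additive.toMul.injective
  ext
  exact Complex.exp_log u.toMul.ne_zero

/-- A character that is trivial on a saturated subgroup has a logarithm that vanishes on it. -/
theorem exists_log (ε : AddSubgroup (Lattice r)) {c : Torus r}
    (hc : c ∈ subgroupLocus (saturation ε)) :
    ∃ w : Lattice r →+ ℂ, (∀ l ∈ saturation ε, w l = 0) ∧
      ∀ l, expHom (w l) = Additive.ofMul (monomialAt l c) := by
  let S : Submodule ℤ (Lattice r) := (saturation ε).toIntSubmodule
  -- The quotient by a saturated subgroup is finitely generated and torsion-free, hence free, so the
  -- character lifts through the exponential map.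
  have htf : Module.IsTorsionFree ℤ (Lattice r ⧸ S) := by
    refine Module.IsTorsionFree.mk fun n hn a b hab => ?_
    have hn0 : n ≠ 0 := hn.ne_zero
    obtain ⟨a, rfl⟩ := Submodule.Quotient.mk_surjective S a
    obtain ⟨b, rfl⟩ := Submodule.Quotient.mk_surjective S b
    simp only [← Submodule.Quotient.mk_smul] at hab
    rw [Submodule.Quotient.eq, ← smul_sub] at hab
    rw [Submodule.Quotient.eq]
    have h1 : n.natAbs • (a - b) ∈ saturation ε := by
      rcases Int.natAbs_eq n with h | h
      · rw [h, natCast_zsmul] at hab; exact hab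
      · rw [h, neg_smul, natCast_zsmul] at hab
        exact neg_mem_iff.1 hab
    obtain ⟨m, hm, h2⟩ := h1
    refine ⟨m * n.natAbs, Nat.mul_pos hm (Int.natAbs_pos.2 hn0), ?_⟩
    rwa [mul_nsmul']
  have hfree : Module.Free ℤ (Lattice r ⧸ S) := inferInstance
  let cbar : Lattice r ⧸ S →ₗ[ℤ] Additive ℂˣ :=
    S.liftQ (torusEquivCharacters c).toIntLinearMap fun l hl => congrArg Additive.ofMul (hc l hl)
  obtain ⟨w, hw⟩ := Module.projective_lifting_property expHom.toIntLinearMap cbar expHom_surjective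
  refine ⟨(w ∘ₗ S.mkQ).toAddMonoidHom, fun l hl => ?_, fun l => ?_⟩
  · change w (S.mkQ l) = 0
    rw [Submodule.mkQ_apply, (Submodule.Quotient.mk_eq_zero S).2 hl, map_zero]
  · exact congrArg (fun ψ => ψ (S.mkQ l)) hw

/-- `V(ε)` is connected if `ε` is saturated. -/
theorem isAffineSubtorus_saturation (ε : AddSubgroup (Lattice r)) :
    IsAffineSubtorus (locusSubgroup (saturation ε)) := by
  refine ⟨isAlgebraic_subgroupLocus _, fun A B hA hB hAB hdisj => ?_⟩
  by_contra! hne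
  obtain ⟨⟨a, ha⟩, b, hb⟩ := hne
  have haV : a ∈ locusSubgroup (saturation ε) := by
    rw [← SetLike.mem_coe, hAB]; exact Or.inl ha
  have hbV : b ∈ locusSubgroup (saturation ε) := by
    rw [← SetLike.mem_coe, hAB]; exact Or.inr hb
  obtain ⟨w, hw0, hw⟩ := exists_log ε (c := b / a) (div_mem hbV haV)
  -- The path `a * exp (t w)` runs from `a` to `b` inside the locus. Preimages of algebraic sets
  -- under it are closed, so `A` and `B` would disconnect the real line.
  let γ : ℝ → Torus r := fun t => torusEquivCharacters.symm
    (torusEquivCharacters a + expHom.comp ((AddMonoidHom.mulLeft (t : ℂ)).comp w))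
  have hγ : ∀ t l, Additive.ofMul (monomialAt l (γ t))
      = Additive.ofMul (monomialAt l a) + expHom (t * w l) := by
    intro t l
    rw [← torusEquivCharacters_apply, Equiv.apply_symm_apply]
    rfl
  have hγval : ∀ t l, (monomialAt l (γ t) : ℂ) = monomialAt l a * Complex.exp (t * w l) :=
    fun t l => congrArg (fun u : Additive ℂˣ => ((u.toMul : ℂˣ) : ℂ)) (hγ t l)
  have hγV : ∀ t, γ t ∈ A ∪ B := by
    intro t
    rw [← hAB]
    intro l hl
    apply Additive.ofMul.injective
    rw [hγ, hw0 l hl, mul_zero, map_zero, add_zero, haV l hl]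
  have hclosed : ∀ Z : Set (Torus r), IsAlgebraic Z → IsClosed {t | γ t ∈ Z} := by
    rintro _ ⟨G, rfl⟩
    have : {t | γ t ∈ zeroLocus G} = ⋂ f ∈ G, {t | evalAt f (γ t) = 0} := by
      ext t; simp [zeroLocus]
    rw [this]
    refine isClosed_biInter fun f _ => isClosed_eq ?_ continuous_const
    simp only [evalAt, hγval]
    fun_prop
  have hcompl : {t | γ t ∈ A}ᶜ = {t | γ t ∈ B} := by
    ext t
    have h1 := hγV t
    have h2 : γ t ∈ A → γ t ∉ B := fun h => Set.disjoint_left.1 hdisj h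
    simp only [Set.mem_compl_iff, Set.mem_ofPred_eq]
    exact ⟨h1.resolve_left, fun h h' => h2 h' h⟩
  have hclopen : IsClopen {t | γ t ∈ A} :=
    ⟨hclosed A hA, by rw [← isClosed_compl_iff, hcompl]; exact hclosed B hB⟩
  have h0 : γ 0 = a := by
    apply torusEquivCharacters.injective
    refine AddMonoidHom.ext fun l => ?_
    rw [torusEquivCharacters_apply, hγ]
    simp [torusEquivCharacters_apply]
  have h1 : γ 1 = b := by
    apply torusEquivCharacters.injective
    refine AddMonoidHom.ext fun l => ?_
    rw [torusEquivCharacters_apply, hγ]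
    simp [torusEquivCharacters_apply, hw, monomialAt_div]
  rcases isClopen_iff.1 hclopen with h | h
  · have : (0 : ℝ) ∈ {t | γ t ∈ A} := by rw [Set.mem_ofPred_eq, h0]; exact ha
    rw [h] at this
    exact this
  · have : (1 : ℝ) ∈ {t | γ t ∈ A} := by rw [h]; trivial
    rw [Set.mem_ofPred_eq, h1] at this
    exact Set.disjoint_left.1 hdisj this hb

/-- If a coset of a group `P` is contained in the zero set of `f`, then the exponents of `f` have
a partition such that the monomials in a common block agree on `P` and such that the block sums
vanish. -/
theorem exists_partition_of_translate_subset {f : Laurent r} {P : Subgroup (Torus r)} {η : Torus r}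
    (h : ∀ p ∈ P, evalAt f (η * p) = 0) :
    ∃ Q : Partitions f, (∀ p ∈ P, ∀ l ∈ diffGroup Q, monomialAt l p = 1) ∧
      psi Q η ∈ inhomSolutions Q := by
  classical
  let φ : Lattice r → (P →* ℂ) := fun l =>
    { toFun := fun p => (monomialAt l p.1 : ℂ)
      map_one' := by simp [monomialAt_one]
      map_mul' := fun p q => by simp [monomialAt_mul] }
  let g : Lattice r → ℂ := fun l => f.coeff l * (monomialAt l η : ℂ)
  have hrel : ∑ χ ∈ (exponents f).image φ,
      (∑ l ∈ exponents f with φ l = χ, g l) • (χ : P → ℂ) = 0 := by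
    funext p
    rw [Finset.sum_apply, Pi.zero_apply, ← h p.1 p.2, evalAt,
      ← Finset.sum_fiberwise_of_maps_to (fun l hl => Finset.mem_image_of_mem φ hl)]
    refine Finset.sum_congr rfl fun χ _ => ?_
    rw [Pi.smul_apply, smul_eq_mul, Finset.sum_mul]
    refine Finset.sum_congr rfl fun l hl => ?_
    rw [← (Finset.mem_filter.1 hl).2, monomialAt_mul]
    push_cast
    simp only [g, φ, MonoidHom.coe_mk, OneHom.coe_mk]
    ring
  have hzero := linearIndependent_iff'.1 (linearIndependent_monoidHom P ℂ) _ _ hrel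
  have hclass : ∀ l ∈ exponents f, ∑ m ∈ exponents f with φ m = φ l, g m = 0 :=
    fun l hl => hzero (φ l) (Finset.mem_image_of_mem φ hl)
  obtain ⟨Q, hQ⟩ := exists_partition_of_classes φ g
    (fun l hl => mul_ne_zero (coeff_ne_zero hl) (Units.ne_zero _)) hclass
  refine ⟨Q, fun p hp l hl => ?_, ?_⟩
  · have hle : diffGroup Q ≤ (torusEquivCharacters p).ker := by
      refine (AddSubgroup.closure_le _).2 ?_
      rintro _ ⟨ν, hν, l, hl, m, hm, rfl⟩
      obtain ⟨k, -, rfl⟩ := hQ ν hν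
      have h1 : φ l = φ m := (Finset.mem_filter.1 hl).2.trans (Finset.mem_filter.1 hm).2.symm
      have h2 : monomialAt l p = monomialAt m p := Units.ext (DFunLike.congr_fun h1 ⟨p, hp⟩)
      refine congrArg Additive.ofMul ?_
      rw [monomialAt_sub, h2, div_self']
    exact Additive.ofMul.injective (hle hl)
  · rw [psi_eq_quotientMap, quotientMap_mem_inhomSolutions]
    intro ν hν
    obtain ⟨k, hk, rfl⟩ := hQ ν hν
    exact hclass k hk

theorem monomialAt_eq_of_mem_famDiffGroup {F : Finset (Laurent r)} {π : PartitionFamilies F}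
    {x y : Torus r} (h : ∀ f, ∀ l ∈ diffGroup (π f), monomialAt l x = monomialAt l y)
    {l : Lattice r} (hl : l ∈ famDiffGroup π) : monomialAt l x = monomialAt l y := by
  have hle : famDiffGroup π ≤ (torusEquivCharacters x).eqLocus (torusEquivCharacters y) :=
    iSup_le fun f l hl => congrArg Additive.ofMul (h f l hl)
  exact Additive.ofMul.injective (hle hl)

theorem maximal_rationalPlane_eq {F : Finset (Laurent r)} {Q : Set (Torus r)}
    (hQ : IsMaximalRationalPlaneIn (zeroLocus (F : Set (Laurent r))) Q) :
    ∃ (π : PartitionFamilies F) (η : Torus r),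
      Q = translate η (subgroupLocus (saturation (famDiffGroup π))) := by
  obtain ⟨⟨η, P, hη, hP, rfl⟩, hQV⟩ := hQ.prop
  choose π hπ hψ using fun f : {f // f ∈ F} =>
    exists_partition_of_translate_subset (f := f.1) (P := P) (η := η) fun p hp =>
      hQV ⟨p, hp, rfl⟩ f.1 f.2
  refine ⟨π, η, ?_⟩
  have hPε : (P : Set (Torus r)) ⊆ subgroupLocus (famDiffGroup π) := by
    intro p hp l hl
    rw [← monomialAt_one l]
    exact monomialAt_eq_of_mem_famDiffGroup
      (fun f l hl => by rw [hπ f p hp l hl, monomialAt_one]) hl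
  have hsub := Set.image_mono (f := fun x => η * x) (hP.subset_saturation hPε)
  refine hQ.eq_of_le ⟨⟨η, _, hη, isAffineSubtorus_saturation (famDiffGroup π), rfl⟩, ?_⟩ hsub
  rintro _ ⟨v, hv, rfl⟩ f hf
  have h1 : psi (π ⟨f, hf⟩) (η * v) = psi (π ⟨f, hf⟩) η := by
    rw [psi_eq_psi_iff]
    intro l hl
    rw [monomialAt_mul, hv l (le_saturation _ (le_iSup (fun g => diffGroup (π g)) ⟨f, hf⟩ hl)),
      mul_one]
  exact evalAt_eq_zero_of_psi_mem (h1 ▸ hψ ⟨f, hf⟩)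

/-! ### Least common multiples and periods -/

theorem setLcm_pos {s : Set ℕ} (hfin : s.Finite) (hpos : ∀ k ∈ s, 0 < k) : 0 < setLcm s := by
  have hne : {m | 0 < m ∧ ∀ k ∈ s, k ∣ m}.Nonempty :=
    ⟨∏ k ∈ hfin.toFinset, k, Finset.prod_pos fun k hk => hpos k (hfin.mem_toFinset.1 hk),
      fun k hk => Finset.dvd_prod_of_mem (fun k => k) (hfin.mem_toFinset.2 hk)⟩
  exact (Nat.sInf_mem hne).1

theorem dvd_setLcm {s : Set ℕ} (hfin : s.Finite) (hpos : ∀ k ∈ s, 0 < k) {k : ℕ} (hk : k ∈ s) :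
    k ∣ setLcm s := by
  have hne : {m | 0 < m ∧ ∀ k ∈ s, k ∣ m}.Nonempty :=
    Nat.nonempty_of_pos_sInf (setLcm_pos hfin hpos)
  exact (Nat.sInf_mem hne).2 k hk

theorem setLcm_dvd {s : Set ℕ} {N : ℕ} (hN : 0 < N) (h : ∀ k ∈ s, k ∣ N) : setLcm s ∣ N := by
  have hne : {m | 0 < m ∧ ∀ k ∈ s, k ∣ m}.Nonempty := ⟨N, hN, h⟩
  have hmem := Nat.sInf_mem hne
  have hgcd : Nat.gcd (setLcm s) N ∈ {m | 0 < m ∧ ∀ k ∈ s, k ∣ m} :=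
    ⟨Nat.gcd_pos_of_pos_right _ hN, fun k hk => Nat.dvd_gcd (hmem.2 k hk) (h k hk)⟩
  have hle : setLcm s ≤ Nat.gcd (setLcm s) N := Nat.sInf_le hgcd
  rw [Nat.le_antisymm hle (Nat.gcd_le_left _ hmem.1)]
  exact Nat.gcd_dvd_right _ _

theorem leastPeriod_dvd {a : ℕ → ℚ} {N : ℕ} (hN : 0 < N) (h : Function.Periodic a N) :
    leastPeriod a ∣ N := by
  have hne : {c | 0 < c ∧ Function.Periodic a c}.Nonempty := ⟨N, hN, h⟩
  obtain ⟨hc0, hc⟩ := Nat.sInf_mem hne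
  change 0 < leastPeriod a at hc0
  change Function.Periodic a (leastPeriod a) at hc
  by_contra hdvd
  have hmod : 0 < N % leastPeriod a := Nat.pos_of_ne_zero fun h0 => hdvd (Nat.dvd_of_mod_eq_zero h0)
  have hper : Function.Periodic a (N % leastPeriod a) := by
    intro n
    have h1 := (hc.nat_mul (N / leastPeriod a)) (n + N % leastPeriod a)
    have h2 : n + N % leastPeriod a + (N / leastPeriod a) * leastPeriod a = n + N := by
      rw [add_assoc, mul_comm, Nat.mod_add_div]
    rw [Nat.cast_id, h2, h n] at h1
    exact h1.symm
  have := Nat.sInf_le (show _ ∈ {c | 0 < c ∧ Function.Periodic a c} from ⟨hmod, hper⟩)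
  exact absurd (Nat.mod_lt N hc0) (not_lt.2 this)

theorem IsPeriodicCoeffs.periodicCoeffs_eq {p : ℕ → ℕ} {a : ℕ → ℕ → ℚ} (h : IsPeriodicCoeffs p a) :
    periodicCoeffs p = a := by
  have hp : IsPolynomialPeriodic p := ⟨a, h⟩
  rw [periodicCoeffs, dif_pos hp]
  exact hp.choose_spec.unique h

theorem IsPeriodicCoeffs.congr {p q : ℕ → ℕ} {a : ℕ → ℕ → ℚ} (h : IsPeriodicCoeffs p a)
    (hpq : ∀ n, 0 < n → q n = p n) : IsPeriodicCoeffs q a := by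
  obtain ⟨h1, d, hd, h2⟩ := h
  exact ⟨h1, d, hd, fun n hn => by rw [hpq n hn, h2 n hn]⟩

/-- A polynomial periodic function that is at least `n ^ e` at all multiples of some positive
integer has a nonzero coefficient in some degree at least `e`. -/
theorem IsPeriodicCoeffs.exists_ge {p : ℕ → ℕ} {a : ℕ → ℕ → ℚ} (h : IsPeriodicCoeffs p a)
    {N e : ℕ} (hN : 0 < N) (hper : ∀ i, Function.Periodic (a i) N) (he : 0 < e)
    (hge : ∀ n, 0 < n → N ∣ n → n ^ e ≤ p n) : ∃ i, e ≤ i ∧ a i ≠ 0 := by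
  by_contra! hzero
  obtain ⟨-, d, -, hp⟩ := h
  let C : ℚ := ∑ i ∈ Finset.range (d + 1), |a i 0|
  have hC : 0 ≤ C := Finset.sum_nonneg fun i _ => abs_nonneg _
  obtain ⟨m, hm⟩ := exists_nat_gt C
  have hm0 : 0 < m := by
    rcases Nat.eq_zero_or_pos m with rfl | h
    · simp at hm; linarith
    · exact h
  set n := m * N with hn
  have hn0 : 0 < n := Nat.mul_pos hm0 hN
  have hn1 : (1 : ℚ) ≤ n := by exact_mod_cast hn0
  have hup : (p n : ℚ) ≤ C * (n : ℚ) ^ (e - 1) := by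
    rw [hp n hn0, Finset.sum_mul]
    refine Finset.sum_le_sum fun i _ => ?_
    by_cases hi : e ≤ i
    · rw [hzero i hi]
      simp
    · have h1 : a i n = a i 0 := by
        have := (hper i).nat_mul m 0
        rwa [zero_add, Nat.cast_id, ← hn] at this
      rw [h1]
      refine (mul_le_mul_of_nonneg_right (le_abs_self _) (by positivity)).trans ?_
      exact mul_le_mul_of_nonneg_left (pow_le_pow_right₀ hn1 (by omega)) (abs_nonneg _)
  have hlow : (n : ℚ) ^ e ≤ p n := by exact_mod_cast hge n hn0 (Dvd.intro_left _ rfl)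
  have hpow : (n : ℚ) ^ e = n * (n : ℚ) ^ (e - 1) := by
    rw [← pow_succ', Nat.sub_add_cancel he]
  rw [hpow] at hlow
  have hpos : (0 : ℚ) < (n : ℚ) ^ (e - 1) := by positivity
  have hnC : (n : ℚ) ≤ C := le_of_mul_le_mul_right (hlow.trans hup) hpos
  have hmn : (m : ℚ) ≤ n := by exact_mod_cast Nat.le_mul_of_pos_right m hN
  linarith

/-! ### The invariants of a finite set of Laurent polynomials -/

variable {F : Finset (Laurent r)}

theorem finite_famTorsionSolutions (π : PartitionFamilies F) : (famTorsionSolutions π).Finite := by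
  have h : famTorsionSolutions π = Set.pi Set.univ fun f => torsionSolutions (π f) := by
    ext s; simp [famTorsionSolutions]
  rw [h]
  exact Set.Finite.pi fun f => finite_torsionSolutions (π f)

theorem orderOf_pos_of_mem {π : PartitionFamilies F} {s : (f : {f // f ∈ F}) → ReducedTorus (π f)}
    (hs : s ∈ famTorsionSolutions π) : 0 < orderOf s := by
  rw [orderOf_pos_iff, isOfFinOrder_iff_pow_eq_one]
  refine ⟨∏ f, orderOf (s f), Finset.prod_pos fun f _ => (hs f).2.orderOf_pos, ?_⟩
  funext f
  obtain ⟨k, hk⟩ := Finset.dvd_prod_of_mem (fun f => orderOf (s f)) (Finset.mem_univ f)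
  rw [Pi.pow_apply, hk, pow_mul, pow_orderOf_eq_one, one_pow]
  rfl

theorem famM_pos (π : PartitionFamilies F) : 0 < famM π :=
  setLcm_pos ((finite_famTorsionSolutions π).image _)
    (by rintro _ ⟨s, hs, rfl⟩; exact orderOf_pos_of_mem hs)

theorem bigM_pos (F : Finset (Laurent r)) : 0 < bigM F :=
  setLcm_pos (Set.finite_range _) (by rintro _ ⟨π, rfl⟩; exact famM_pos π)

theorem bigD_pos (F : Finset (Laurent r)) : 0 < bigD F :=
  setLcm_pos (Set.finite_range _) (by rintro _ ⟨U, rfl⟩; exact torsionExponent_pos _)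

theorem orderOf_dvd_bigM {π : PartitionFamilies F} {s : (f : {f // f ∈ F}) → ReducedTorus (π f)}
    (hs : s ∈ famTorsionSolutions π) : orderOf s ∣ bigM F := by
  refine (dvd_setLcm ((finite_famTorsionSolutions π).image _)
    (by rintro _ ⟨s, hs, rfl⟩; exact orderOf_pos_of_mem hs) (Set.mem_image_of_mem _ hs)).trans ?_
  exact dvd_setLcm (Set.finite_range _) (by rintro _ ⟨π, rfl⟩; exact famM_pos π) ⟨π, rfl⟩

theorem torsionExponent_dvd_bigD (U : Set (PartitionFamilies F)) :
    torsionExponent (unionDiffGroup U) ∣ bigD F :=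
  dvd_setLcm (Set.finite_range _) (by rintro _ ⟨U, rfl⟩; exact torsionExponent_pos _) ⟨U, rfl⟩

theorem torsionExponent_famDiffGroup_dvd_bigD (π : PartitionFamilies F) :
    torsionExponent (famDiffGroup π) ∣ bigD F := by
  have h := torsionExponent_dvd_bigD {π}
  rwa [unionDiffGroup, iSup_singleton] at h

/-- The points of the torus over `s ∈ S(π, F)`. -/
def solutionFiber (k : Σ π : PartitionFamilies F, famTorsionSolutions π) : Set (Torus r) :=
  {x | ∀ f, psi (k.1 f) x = k.2.1 f}

theorem psi_eq_psi_iff_famDiffGroup (π : PartitionFamilies F) (x y : Torus r) :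
    (∀ f, psi (π f) x = psi (π f) y) ↔ ∀ l ∈ famDiffGroup π, monomialAt l x = monomialAt l y := by
  constructor
  · exact fun h l hl => monomialAt_eq_of_mem_famDiffGroup
      (fun f => (psi_eq_psi_iff (π f) x y).1 (h f)) hl
  · exact fun h f => (psi_eq_psi_iff (π f) x y).2 fun l hl =>
      h l (le_iSup (fun g => diffGroup (π g)) f hl)

theorem isCosetFamily_solutionFiber :
    IsCosetFamily (solutionFiber (F := F)) fun k => famDiffGroup k.1 := by
  intro k η hη x
  rw [← psi_eq_psi_iff_famDiffGroup]
  exact forall_congr' fun f => by rw [hη f]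

theorem psi_pow {f : Laurent r} (P : Partitions f) (x : Torus r) (n : ℕ) :
    psi P (x ^ n) = psi P x ^ n := by
  funext ν l
  exact monomialAt_pow _ _ _

theorem psi_one {f : Laurent r} (P : Partitions f) : psi P (1 : Torus r) = 1 := by
  funext ν l
  exact monomialAt_one _

theorem monomialAt_pow_bigM (k : Σ π : PartitionFamilies F, famTorsionSolutions π) (η : Torus r)
    (hη : η ∈ solutionFiber k) (l : Lattice r) (hl : l ∈ famDiffGroup k.1) :
    monomialAt l η ^ bigM F = 1 := by
  rw [← monomialAt_pow, ← monomialAt_one l]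
  refine (psi_eq_psi_iff_famDiffGroup k.1 _ _).1 (fun f => ?_) l hl
  obtain ⟨q, hq⟩ := orderOf_dvd_bigM k.2.2
  have h1 : k.2.1 ^ bigM F = 1 := by rw [hq, pow_mul, pow_orderOf_eq_one, one_pow]
  rw [psi_pow, hη f, psi_one]
  exact congrFun h1 f

theorem torsionExponent_iSup_dvd_bigD
    (K : Finset (Σ π : PartitionFamilies F, famTorsionSolutions π)) :
    torsionExponent (⨆ k ∈ K, famDiffGroup k.1) ∣ bigD F := by
  have h : (⨆ k ∈ K, famDiffGroup k.1) = unionDiffGroup ((fun k => k.1) '' {k | k ∈ K}) := by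
    rw [unionDiffGroup, iSup_image]
    rfl
  rw [h]
  exact torsionExponent_dvd_bigD _

theorem solutionFiber_subset_zeroLocus (k : Σ π : PartitionFamilies F, famTorsionSolutions π) :
    solutionFiber k ⊆ zeroLocus (F : Set (Laurent r)) := by
  intro x hx f hf
  refine evalAt_eq_zero_of_psi_mem (P := k.1 ⟨f, hf⟩) ?_
  rw [hx ⟨f, hf⟩]
  exact (k.2.2 ⟨f, hf⟩).1.1

theorem torsionCount_zeroLocus (F : Finset (Laurent r)) {n : ℕ} (hn : 0 < n) :
    torsionCount (zeroLocus (F : Set (Laurent r))) n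
      = torsionCount (⋃ k, solutionFiber (F := F) k) n := by
  rw [torsionCount, torsionCount]
  congr 1
  ext x
  refine and_congr_left fun hx => ⟨fun h => ?_, fun h => ?_⟩
  · choose π hπ using fun f : {f // f ∈ F} => exists_psi_mem_maximalSolutions (h f.1 f.2)
    refine Set.mem_iUnion.2 ⟨⟨π, fun f => psi (π f) x, fun f => ⟨hπ f, ?_⟩⟩, fun f => rfl⟩
    rw [isOfFinOrder_iff_pow_eq_one]
    exact ⟨n, hn, by rw [← psi_pow, hx, psi_one]⟩
  · obtain ⟨k, hk⟩ := Set.mem_iUnion.1 h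
    exact solutionFiber_subset_zeroLocus k hk

theorem delta_eq_one_of_nonempty {k : Σ π : PartitionFamilies F, famTorsionSolutions π}
    (h : (solutionFiber k).Nonempty) : delta k.1 = 1 := by
  obtain ⟨x, hx⟩ := h
  rw [delta, if_pos]
  refine ⟨gammaDual k.1 fun _ => x, ⟨fun _ => x, fun f => ?_, rfl⟩, restrictPoint _ x, rfl⟩
  change psi (k.1 f) x ∈ _
  rw [hx f]
  exact k.2.2 f

theorem exists_nonempty_of_delta_ne_zero {π : PartitionFamilies F} (h : delta π ≠ 0) :
    ∃ s : famTorsionSolutions π, (solutionFiber ⟨π, s⟩).Nonempty := by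
  have hne : (solutionCharacters π ∩ Set.range (rhoDual π)).Nonempty := by
    by_contra h0
    exact h (by rw [delta, if_neg h0])
  obtain ⟨_, ⟨η, hη, rfl⟩, χ, hχ⟩ := hne
  obtain ⟨x, hx, -⟩ := exists_common_extension (famDiffGroup π) ⊥ χ 0 (by
    rintro l hl hl'
    obtain rfl := AddSubgroup.mem_bot.1 hl'
    exact χ.map_zero)
  refine ⟨⟨_, hη⟩, x, fun f => ?_⟩
  rw [psi_eq_psi_iff]
  intro l hl
  apply Additive.ofMul.injective
  have h1 := DFunLike.congr_fun (congrFun hχ f) ⟨l, hl⟩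
  exact (hx ⟨l, le_iSup (fun g => diffGroup (π g)) f hl⟩).trans h1

theorem ppDegree_eq_of_forall {p : ℕ → ℕ} {a : ℕ → ℕ → ℚ} (h : IsPeriodicCoeffs p a) {d : ℕ}
    (hle : ∀ i, a i ≠ 0 → i ≤ d) (hge : 0 < d → ∃ i, d ≤ i ∧ a i ≠ 0) : ppDegree p = d := by
  rw [ppDegree, h.periodicCoeffs_eq]
  have hbdd : BddAbove {i | a i ≠ 0} := ⟨d, fun i hi => hle i hi⟩
  refine le_antisymm ?_ ?_
  · rcases Set.eq_empty_or_nonempty {i | a i ≠ 0} with h0 | h0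
    · rw [h0]; simp
    · exact csSup_le h0 fun i hi => hle i hi
  · rcases Nat.eq_zero_or_pos d with rfl | hd
    · exact Nat.zero_le _
    · obtain ⟨i, hdi, hi⟩ := hge hd
      exact hdi.trans (le_csSup hbdd hi)

end TorsionCount

end

theorem theorem3 (r : ℕ) (F : Finset (TorsionCount.Laurent r)) :
    -- maximal rational planes in `V(F)`
    (∀ Q : Set (TorsionCount.Torus r),
      TorsionCount.IsMaximalRationalPlaneIn (TorsionCount.zeroLocus (F : Set (TorsionCount.Laurent r))) Q →
        ∃ (π : TorsionCount.PartitionFamilies F) (η : TorsionCount.Torus r),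
          Q = TorsionCount.translate η (TorsionCount.subgroupLocus
            (TorsionCount.saturation (TorsionCount.famDiffGroup π)))) ∧
    -- finiteness of the sets `S(π, F)` and polynomial periodicity of `p_V`
    (∀ π : TorsionCount.PartitionFamilies F, (TorsionCount.famTorsionSolutions π).Finite) ∧
    TorsionCount.IsPolynomialPeriodic
      (TorsionCount.torsionCount (TorsionCount.zeroLocus (F : Set (TorsionCount.Laurent r)))) ∧
    -- the degree of `p_V`
    TorsionCount.ppDegree (TorsionCount.torsionCount (TorsionCount.zeroLocus (F : Set (TorsionCount.Laurent r)))) =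
      (⨆ π : TorsionCount.PartitionFamilies F,
        (r - Module.finrank ℤ (TorsionCount.saturation (TorsionCount.famDiffGroup π))) *
          TorsionCount.delta π) ∧
    -- the period of `p_V`
    TorsionCount.ppPeriod (TorsionCount.torsionCount (TorsionCount.zeroLocus (F : Set (TorsionCount.Laurent r)))) ∣
      TorsionCount.bigM F * TorsionCount.bigD F := by
  have hfin : ∀ π : TorsionCount.PartitionFamilies F, Finite (TorsionCount.famTorsionSolutions π) :=
    fun π => (TorsionCount.finite_famTorsionSolutions π).to_subtype
  have hpos : 0 < TorsionCount.bigM F * TorsionCount.bigD F :=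
    Nat.mul_pos (TorsionCount.bigM_pos F) (TorsionCount.bigD_pos F)
  obtain ⟨a, ha, hper, hne⟩ := TorsionCount.exists_periodicCoeffs_iUnion
    TorsionCount.isCosetFamily_solutionFiber (TorsionCount.bigM_pos F) (TorsionCount.bigD_pos F)
    TorsionCount.monomialAt_pow_bigM TorsionCount.torsionExponent_iSup_dvd_bigD
  replace ha := ha.congr fun n hn => TorsionCount.torsionCount_zeroLocus F hn
  refine ⟨fun Q hQ => TorsionCount.maximal_rationalPlane_eq hQ,
    TorsionCount.finite_famTorsionSolutions, ⟨a, ha⟩, ?_, ?_⟩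
  · have hbdd := Set.Finite.bddAbove (Set.finite_range fun π : TorsionCount.PartitionFamilies F =>
      (r - Module.finrank ℤ (TorsionCount.saturation (TorsionCount.famDiffGroup π))) *
        TorsionCount.delta π)
    refine TorsionCount.ppDegree_eq_of_forall ha (fun i hi => ?_) (fun hd => ?_)
    · obtain ⟨k, hk, hik⟩ := hne i hi
      refine le_trans ?_ (le_ciSup hbdd k.1)
      rw [TorsionCount.delta_eq_one_of_nonempty hk, mul_one, TorsionCount.finrank_saturation]
      exact hik
    · have hnonempty : Nonempty (TorsionCount.PartitionFamilies F) := by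
        by_contra hempty
        rw [not_nonempty_iff] at hempty
        simp at hd
      obtain ⟨π, hπ⟩ := Set.Nonempty.csSup_mem (Set.range_nonempty _) (Set.finite_range
        fun π : TorsionCount.PartitionFamilies F =>
          (r - Module.finrank ℤ (TorsionCount.saturation (TorsionCount.famDiffGroup π))) *
            TorsionCount.delta π)
      change _ = iSup _ at hπ
      rw [← hπ] at hd ⊢
      have hδ : TorsionCount.delta π ≠ 0 := fun h => by simp [h] at hd
      obtain ⟨s, η, hη⟩ := TorsionCount.exists_nonempty_of_delta_ne_zero hδ
      refine ha.exists_ge hpos hper hd fun n hn hdvd => ?_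
      dsimp only
      rw [TorsionCount.delta_eq_one_of_nonempty ⟨η, hη⟩, mul_one, TorsionCount.finrank_saturation]
      exact TorsionCount.pow_le_torsionCount (TorsionCount.solutionFiber_subset_zeroLocus ⟨π, s⟩)
        (TorsionCount.isCosetFamily_solutionFiber _ η hη)
        (TorsionCount.monomialAt_pow_bigM _ η hη)
        (TorsionCount.torsionExponent_famDiffGroup_dvd_bigD π) hn hdvd
  · rw [TorsionCount.ppPeriod, ha.periodicCoeffs_eq]
    refine TorsionCount.setLcm_dvd hpos ?_
    rintro _ ⟨i, rfl⟩
    exact TorsionCount.leastPeriod_dvd hpos (hper i)
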